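/- Let $K\in\mathbb N$, $\mathcal K=\{1,\dots,K\}$, $\lambda_1,\dots,\lambda_K>0$, $\alpha_0>0$, and let $\beta_m>0$ $(m=1,2,\dots)$ satisfy $\beta_m\ll 1/m$, i.e. $m\beta_m\to0$ as $m\to\infty$. For each $m\ge1$ consider the following $m$-th system $W^m(t)=(Q^m(t),C^m(t))\in\mathbb Z_+^{\mathcal K}\times\mathcal K$, $t\ge 0$. While $C^m(t)=k$, unit rewards of action $k$ are accrued according to a Poisson process of rate $\lambda_k$ (and no rewards of other actions are accrued); every reward disappears after an independent exponential lifespan of rate $1/m$; $Q^m_k(t)$ is the number of rewards of action $k$ present at time $t$. Update points $0<S^m_1<S^m_2<\cdots$ form an independent Poisson process of rate $\beta_m$; at an update point $t$ a new choice is sampled, equal to $k$ with probability $$\frac{Q^m_k(t)\vee(\alpha_0 m)}{\sum_{i\in\mathcal K}\big(Q^m_i(t)\vee(\alpha_0 m)\big)},\qquad k\in\mathcal K,$$ and $C^m$ is constant between update points. Put $S^m_0=0$, $C^m[n]=C^m(S^m_n)$, $\overline Q^m[n]=m^{-1}Q^m(S^m_n)$ and $q^*_{k,i}=\lambda_k\,\mathbb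 I(k=i)$ for $k,i\in\mathcal K$. Suppose that, for every $m\ge1$, the process $W^m(\cdot)$ is initialized at $t=0$ according to a steady-state (stationary) distribution of $W^m(\cdot)$. Then $\mathbb P(C^m[0]=k)>0$ for all $m\ge1$ and $k\in\mathcal K$, and for all $i,k\in\mathcal K$, $$\lim_{m\to\infty}\mathbb P\Big(\big|\overline Q^m_i[1]-q^*_{k,i}\big|\le\epsilon\ \Big|\ C^m[0]=k\Big)=1\qquad\text{for all }\epsilon>0.$$ Moreover, for every function $h:\mathbb N\to\mathbb Z_+$ with $\lim_{m\to\infty}h(m)/m=\infty$ and $\lim_{m\to\infty}h(m)\beta_m=0$, and for all $i,k\in\mathcal K$, $$\lim_{m\to\infty}\mathbb E\Big(\big|m^{-1}Q^m_i(h(m))-q^*_{k,i}\big|\ \Big|\ C^m[0]=k\Big)=0.$$ -/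

import Mathlib

open MeasureTheory ProbabilityTheory Filter Topology Asymptotics
open scoped ENNReal

noncomputable section

namespace FadingMemory

/-- The parameters of one system with `K` actions: the reward rates of the actions, the exploration
parameter, the rate of the update points and the rate at which a reward is forgotten. -/
structure Params (K : ℕ) where
  rewardRate : Fin K → ℝ
  explore : ℝ
  updateRate : ℝ
  decayRate : ℝ

/-- A state `(q, c)`: the recallable rewards of every action and the current choice. -/
abbrev State (K : ℕ) : Type := (Fin K → ℕ) × Fin K

/-- The labels of the independent real random variables that drive the system.
* `initialLife k j`: residual lifespan of the `j`-th reward of action `k` present at time `0`;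
* `rewardGap k j`: the gaps of the Poisson process of potential rewards of action `k`;
* `life k j`: lifespan of the `j`-th potential reward of action `k`;
* `updateGap n`: the gaps between consecutive update points;
* `coin n`: the randomization used for the choice at the `(n+1)`-st update point. -/
inductive Clock (K : ℕ) : Type
  | initialLife (k : Fin K) (j : ℕ)
  | rewardGap (k : Fin K) (j : ℕ)
  | life (k : Fin K) (j : ℕ)
  | updateGap (n : ℕ)
  | coin (n : ℕ)

/-- A sample point: an initial state together with the values of all driving variables. -/
abbrev Sample (K : ℕ) : Type := State K × (Clock K → ℝ)

variable {K : ℕ}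

/-- The laws of the driving variables: exponential with the respective rate for the gaps and the
lifespans, uniform on `[0, 1]` for the coins. -/
def clockLaw (p : Params K) : Clock K → Measure ℝ
  | .initialLife _ _ => expMeasure p.decayRate
  | .rewardGap k _ => expMeasure (p.rewardRate k)
  | .life _ _ => expMeasure p.decayRate
  | .updateGap _ => expMeasure p.updateRate
  | .coin _ => volume.restrict (Set.Icc 0 1)

/-- The law of the system started from the distribution `π`: the initial state has law `π`, and it
and all driving variables are mutually independent. -/
def systemLaw (p : Params K) (π : Measure (State K)) : Measure (Sample K) :=
  π.prod (Measure.infinitePi (clockLaw p))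

/-- The update points `S 0 = 0 < S 1 < S 2 < ...`, a Poisson process. -/
def updateTime (ω : Sample K) (n : ℕ) : ℝ :=
  ∑ j ∈ Finset.range n, ω.2 (.updateGap j)

/-- The number of update points in `(0, t]`. -/
def updateCount (ω : Sample K) (t : ℝ) : ℕ :=
  {n : ℕ | updateTime ω (n + 1) ≤ t}.ncard

/-- The time of the `j`-th potential reward of action `k`. -/
def rewardTime (ω : Sample K) (k : Fin K) (j : ℕ) : ℝ :=
  ∑ i ∈ Finset.range (j + 1), ω.2 (.rewardGap k i)

/-- The recallable rewards of action `k` at time `t` when `c n` is the action in force from the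
`n`-th to the `(n+1)`-st update point: the initial rewards that are still alive, plus the potential
rewards that came up to time `t`, came while `k` was in force (only these are accrued), and are
still alive. Since `c` is chosen without anticipation, rewards of action `k` are thus accrued as a
Poisson process of rate `rewardRate k` while `k` is in force, and not at all otherwise. -/
def rewardsUnder (ω : Sample K) (c : ℕ → Fin K) (t : ℝ) (k : Fin K) : ℕ :=
  {j : ℕ | j < ω.1.1 k ∧ t < ω.2 (.initialLife k j)}.ncard +
  {j : ℕ | rewardTime ω k j ≤ t ∧ c (updateCount ω (rewardTime ω k j)) = k ∧
    t < rewardTime ω k j + ω.2 (.life k j)}.ncard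

open Classical in
/-- Sampling an action with probabilities proportional to the weights `w` by inversion: the least
`k` with `u * ∑ i, w i < ∑ i ≤ k, w i`. The default value `c` is used only outside `u < 1`. -/
def sampleAction (w : Fin K → ℝ) (u : ℝ) (c : Fin K) : Fin K :=
  if h : ∃ k : Fin K, u * ∑ i, w i < ∑ i ∈ Finset.Iic k, w i then Fin.find _ h else c

/-- The choices made up to the `n`-th update point (constant from index `n` on). At the `(n+1)`-st
update point the reward matching rule samples action `k` with probability
`(Q k ⊔ α) / ∑ i, (Q i ⊔ α)`, where `Q` is the recallable reward vector at that point. -/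
def choiceHistory (p : Params K) (ω : Sample K) : ℕ → ℕ → Fin K
  | 0 => fun _ => ω.1.2
  | n + 1 => fun j =>
      if j ≤ n then choiceHistory p ω n j
      else sampleAction
        (fun k => max (rewardsUnder ω (choiceHistory p ω n) (updateTime ω (n + 1)) k : ℝ) p.explore)
        (ω.2 (.coin n)) (choiceHistory p ω n n)

/-- The choice made at the `n`-th update point. -/
def choiceSeq (p : Params K) (ω : Sample K) (n : ℕ) : Fin K :=
  choiceHistory p ω n n

/-- The choice process `C(t)`. -/
def choice (p : Params K) (t : ℝ) (ω : Sample K) : Fin K :=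
  choiceSeq p ω (updateCount ω t)

/-- The recallable reward process `Q(t)`. -/
def rewards (p : Params K) (t : ℝ) (ω : Sample K) (k : Fin K) : ℕ :=
  rewardsUnder ω (choiceSeq p ω) t k

/-- The joint process `W(t) = (Q(t), C(t))`. -/
def joint (p : Params K) (t : ℝ) (ω : Sample K) : State K :=
  (rewards p t ω, choice p t ω)

/-- The embedded choice process `C[n] = C(S n)`. -/
def embeddedChoice (p : Params K) (n : ℕ) (ω : Sample K) : Fin K :=
  choice p (updateTime ω n) ω

/-- The embedded reward process `Q[n] = Q(S n)`. -/
def embeddedRewards (p : Params K) (n : ℕ) (ω : Sample K) : Fin K → ℕ :=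
  rewards p (updateTime ω n) ω

/-- `π` is a steady-state distribution of the joint process: a probability measure such that the
process started from `π` has law `π` at all times. (The state space is countable and discrete.) -/
def IsSteadyState (p : Params K) (π : Measure (State K)) : Prop :=
  IsProbabilityMeasure π ∧
    ∀ t : ℝ, 0 ≤ t → ∀ w : State K, systemLaw p π {ω | joint p t ω = w} = π {w}

/-- The `m`-th system of the scaling regime: `μ = 1 / m` and `α = α₀ * m`. -/
def scaledParams (lam : Fin K → ℝ) (α₀ : ℝ) (β : ℕ → ℝ) (m : ℕ) : Params K where
  rewardRate := lam
  explore := α₀ * m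
  updateRate := β m
  decayRate := 1 / m

/-- The matrix `q*` with entries `λ k` on the diagonal and `0` elsewhere. -/
def qStar (lam : Fin K → ℝ) (k i : Fin K) : ℝ := if k = i then lam k else 0

end FadingMemory

end

/-!
The rewards of every action are compared with those of the process that accrues *all* potential
rewards. For action `i` let `aliveCount i s` be the number of potential rewards that are alive at
time `s`; it depends neither on the choices nor on the update points, and it is the number of
customers in an infinite-server queue started empty. Always `Q_i(s) ≤ initialAlive i s +
aliveCount i s` (`rewardsUnder_le`), where the first summand counts the initial rewards that
survive, and as long as the initial choice `k` is in force this becomes `Q_i(s) = initialAlive i s +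
𝟙(i = k) aliveCount i s` (`rewards_eq`).

With decay rate `1 / m`, the count `aliveCount i s` divided by `m` is close to `λ_i` as soon as
`s ≫ m`. This follows from its first two moments (`lintegral_aliveDev_le`), which are computed from
the renewal identity `tsum_expStep`: the arrival times, being sums of independent exponential gaps,
have constant intensity `λ_i`.

The initial rewards disappear over times `s ≫ m`, because in steady state their mean is at most
`λ_i m` (`IsSteadyState.lintegral_reward_le`): stationarity lets the initial law be replaced by the
law at a late time, when only the potential rewards count.

The relevant times are long enough for this, since the first update point is exponential of rate
`β_m ≪ 1 / m`, and at the fixed time `h(m) ≫ m` no update point has occurred with probability at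
least `1 - h(m) β_m → 1`. On the exceptional event the error is controlled in mean, as
`aliveCount` is independent of the update points.

It remains to condition on the initial choice. Its probability is bounded below uniformly in `m`
(`IsSteadyState.le_measure_choice`), so that conditioning costs only a constant factor: at time
`1 / β_m` there has been exactly one update point with probability bounded below, at this point at
most a constant times `m` rewards are present with conditional probability at least one half, and
then every action is sampled with probability bounded below, thanks to the exploration parameter
`α₀ m`.

Independence is used throughout in the form of `lintegral_resample`: replacing one driving variable
by an independent copy preserves the law. Whether the choice process is measurable is never needed;
where an event that involves it occurs, outer measures suffice.
-/

namespace FadingMemory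

/-! ### Exponential laws and the Poisson process -/

theorem lintegral_expMeasure {r : ℝ} {f : ℝ → ℝ≥0∞} (hf : Measurable f) :
    ∫⁻ x, f x ∂expMeasure r =
      ∫⁻ x in Set.Ioi 0, ENNReal.ofReal (r * Real.exp (-(r * x))) * f x := by
  have h1 : expMeasure r = volume.withDensity (exponentialPDF r) := rfl
  have hm : Measurable (exponentialPDF r) := (measurable_exponentialPDFReal r).ennreal_ofReal
  rw [h1, lintegral_withDensity_eq_lintegral_mul _ hm hf,
    ← setLIntegral_congr (Ioi_ae_eq_Ici (a := (0 : ℝ))).symm,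
    ← lintegral_indicator measurableSet_Ici]
  refine lintegral_congr fun x => ?_
  by_cases hx : 0 ≤ x
  · simp [Set.indicator, hx, exponentialPDF_of_nonneg]
  · simp [Set.indicator, hx, exponentialPDF_of_neg (not_le.1 hx)]

instance nullSingletonClass_expMeasure (r : ℝ) : NullSingletonClass (expMeasure r) :=
  inferInstanceAs (NullSingletonClass (volume.withDensity (exponentialPDF r)))

theorem expMeasure_Iic {r t : ℝ} (hr : 0 < r) (ht : 0 ≤ t) :
    expMeasure r (Set.Iic t) = ENNReal.ofReal (1 - Real.exp (-(r * t))) := by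
  have h1 : expMeasure r = volume.withDensity (exponentialPDF r) := rfl
  rw [h1, withDensity_apply _ measurableSet_Iic, lintegral_exponentialPDF_eq_antiDeriv hr,
    if_pos ht]

theorem expMeasure_Ioi {r t : ℝ} (hr : 0 < r) (ht : 0 ≤ t) :
    expMeasure r (Set.Ioi t) = ENNReal.ofReal (Real.exp (-(r * t))) := by
  have := isProbabilityMeasure_expMeasure hr
  rw [← Set.compl_Iic, prob_compl_eq_one_sub measurableSet_Iic, expMeasure_Iic hr ht,
    ← ENNReal.ofReal_one, ← ENNReal.ofReal_sub]
  · simp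
  · simpa using mul_nonneg hr.le ht

theorem ae_pos_expMeasure {r : ℝ} (hr : 0 < r) : ∀ᵐ x ∂expMeasure r, 0 < x := by
  rw [ae_iff]
  simpa [Set.Iic_def] using expMeasure_Iic hr le_rfl

theorem lintegral_exp_neg_expMeasure {r s : ℝ} (hr : 0 < r) (hs : 0 < s) :
    ∫⁻ x, ENNReal.ofReal (Real.exp (-(s * x))) ∂expMeasure r = ENNReal.ofReal (r / (r + s)) := by
  have h1 : 0 < r + s := by positivity
  have := isProbabilityMeasure_expMeasure h1
  have h2 : ∫⁻ x, 1 ∂expMeasure (r + s) = 1 := by simp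
  rw [lintegral_expMeasure measurable_const] at h2
  rw [lintegral_expMeasure (by fun_prop)]
  calc _ = ∫⁻ x in Set.Ioi 0, ENNReal.ofReal (r / (r + s)) *
        (ENNReal.ofReal ((r + s) * Real.exp (-((r + s) * x))) * 1) := by
        refine lintegral_congr fun x => ?_
        rw [mul_one, ← ENNReal.ofReal_mul (by positivity), ← ENNReal.ofReal_mul (by positivity)]
        congr 1
        rw [← mul_assoc, div_mul_cancel₀ _ h1.ne', mul_assoc, ← Real.exp_add]
        ring_nf
    _ = _ := by
        rw [lintegral_const_mul _ (by fun_prop), h2, mul_one]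

/-- The transition operator of the random walk whose steps are exponential with rate `r`. -/
noncomputable def expStep (r : ℝ) (f : ℝ → ℝ≥0∞) (u : ℝ) : ℝ≥0∞ :=
  ∫⁻ x, f (u + x) ∂expMeasure r

theorem measurable_expStep {r : ℝ} (hr : 0 < r) {f : ℝ → ℝ≥0∞} (hf : Measurable f) :
    Measurable (expStep r f) := by
  have := isProbabilityMeasure_expMeasure hr
  exact Measurable.lintegral_prod_right' (f := fun q : ℝ × ℝ => f (q.1 + q.2)) (by fun_prop)

theorem measurable_expStep_iterate {r : ℝ} (hr : 0 < r) {f : ℝ → ℝ≥0∞} (hf : Measurable f)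
    (n : ℕ) : Measurable ((expStep r)^[n] f) := by
  induction n with
  | zero => exact hf
  | succ n ih =>
    rw [Function.iterate_succ_apply']
    exact measurable_expStep hr ih

/-- The position after `n + 1` exponential steps has a Gamma density. -/
theorem expStep_iterate_succ {r : ℝ} (hr : 0 < r) (n : ℕ) {f : ℝ → ℝ≥0∞} (hf : Measurable f)
    (u : ℝ) :
    (expStep r)^[n + 1] f u =
      ∫⁻ x in Set.Ioi 0,
        ENNReal.ofReal (r ^ (n + 1) * (x ^ n / n.factorial) * Real.exp (-(r * x))) * f (u + x) := by
  induction n generalizing f u with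
  | zero =>
    simp only [zero_add, Function.iterate_one, expStep]
    rw [lintegral_expMeasure (by fun_prop)]
    simp
  | succ n ih =>
    rw [Function.iterate_succ_apply, ih (measurable_expStep hr hf)]
    -- the position `z = x + y` after the last step `y` becomes the inner variable
    have h1 : ∀ x : ℝ, expStep r f (u + x) =
        ∫⁻ z, (Set.Ioi x).indicator (fun z => ENNReal.ofReal (r * Real.exp (-(r * (z - x)))) *
          f (u + z)) z := by
      intro x
      rw [expStep, lintegral_expMeasure (by fun_prop), ← lintegral_indicator measurableSet_Ioi,
        ← lintegral_add_right_eq_self ((Set.Ioi x).indicator _) x]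
      refine lintegral_congr fun y => ?_
      simp only [Set.indicator, Set.mem_Ioi, lt_add_iff_pos_left, add_sub_cancel_right]
      rw [add_assoc, add_comm y x]
    simp only [h1]
    have h2 : ∀ x : ℝ, ENNReal.ofReal (r ^ (n + 1) * (x ^ n / n.factorial) * Real.exp (-(r * x))) *
        ∫⁻ z, (Set.Ioi x).indicator (fun z => ENNReal.ofReal (r * Real.exp (-(r * (z - x)))) *
          f (u + z)) z = ∫⁻ z, {q : ℝ × ℝ | q.1 < q.2}.indicator (fun q : ℝ × ℝ =>
          ENNReal.ofReal (r ^ (n + 1) * (q.1 ^ n / n.factorial) * Real.exp (-(r * q.1))) *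
           (ENNReal.ofReal (r * Real.exp (-(r * (q.2 - q.1)))) * f (u + q.2))) (x, z) := by
      intro x
      rw [← lintegral_const_mul]
      · refine lintegral_congr fun z => ?_
        by_cases h : x < z <;> simp [Set.indicator, h]
      · exact Measurable.indicator (by fun_prop) measurableSet_Ioi
    simp only [h2]
    -- given the final position `z`, the density of the intermediate position `x` is `x ^ n`, up to
    -- a factor that depends on `z` only
    rw [lintegral_lintegral_swap]
    swap
    · refine Measurable.aemeasurable ?_
      refine Measurable.indicator (by fun_prop) ?_
      exact measurableSet_lt measurable_fst measurable_snd
    rw [← lintegral_indicator measurableSet_Ioi]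
    refine lintegral_congr fun z => ?_
    by_cases hz : 0 < z
    · simp only [Set.indicator, Set.mem_Ioi, hz, if_true, Set.mem_ofPred_eq]
      have h3 : ∫⁻ x in Set.Ioi (0 : ℝ), (if x < z then
          ENNReal.ofReal (r ^ (n + 1) * (x ^ n / n.factorial) * Real.exp (-(r * x))) *
           (ENNReal.ofReal (r * Real.exp (-(r * (z - x)))) * f (u + z)) else 0) =
          ∫⁻ x in Set.Ioo (0 : ℝ) z, ENNReal.ofReal (x ^ n) *
            (ENNReal.ofReal (r ^ (n + 2) / n.factorial * Real.exp (-(r * z))) * f (u + z)) := by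
        rw [← lintegral_indicator measurableSet_Ioi, ← lintegral_indicator measurableSet_Ioo]
        refine lintegral_congr fun x => ?_
        by_cases hx : 0 < x
        · by_cases hxz : x < z
          · simp only [Set.indicator, Set.mem_Ioi, Set.mem_Ioo, hx, hxz, if_true, and_self]
            rw [← mul_assoc, ← mul_assoc, ← ENNReal.ofReal_mul (by positivity),
              ← ENNReal.ofReal_mul (by positivity)]
            congr 2
            have : Real.exp (-(r * z)) = Real.exp (-(r * x)) * Real.exp (-(r * (z - x))) := by
              rw [← Real.exp_add]; ring_nf
            rw [this]; ring
          · simp [Set.indicator, hx, hxz]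
        · simp [Set.indicator, hx]
      rw [h3, lintegral_mul_const _ (by fun_prop), ← mul_assoc]
      congr 1
      have h4 : ∫⁻ x in Set.Ioo (0 : ℝ) z, ENNReal.ofReal (x ^ n) =
          ENNReal.ofReal (z ^ (n + 1) / (n + 1)) := by
        rw [setLIntegral_congr Ioo_ae_eq_Ioc, ← ofReal_integral_eq_lintegral_ofReal]
        · rw [← intervalIntegral.integral_of_le hz.le, integral_pow]
          simp
        · exact ((continuous_pow n).integrableOn_Icc).mono_set Set.Ioc_subset_Icc_self
        · exact (ae_restrict_mem measurableSet_Ioc).mono fun x hx => pow_nonneg hx.1.le n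
      rw [h4, ← ENNReal.ofReal_mul (by positivity)]
      congr 1
      rw [Nat.factorial_succ]
      push_cast
      field_simp
    · simp only [Set.indicator, Set.mem_Ioi, hz, if_false, Set.mem_ofPred_eq]
      rw [← lintegral_indicator measurableSet_Ioi]
      refine (lintegral_congr fun x => ?_).trans lintegral_zero
      by_cases hx : 0 < x
      · have : ¬ x < z := fun h => hz (hx.trans h)
        simp [Set.indicator, this]
      · simp [Set.indicator, hx]

/-- The renewal measure of exponential steps is a multiple of Lebesgue measure: a Poisson process
of rate `r` has constant intensity `r`. -/
theorem tsum_expStep {r : ℝ} (hr : 0 < r) {f : ℝ → ℝ≥0∞} (hf : Measurable f) (u : ℝ) :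
    ∑' n : ℕ, (expStep r)^[n + 1] f u = ENNReal.ofReal r * ∫⁻ x in Set.Ioi 0, f (u + x) := by
  simp only [expStep_iterate_succ hr _ hf]
  rw [← lintegral_tsum (fun n => by fun_prop), ← lintegral_const_mul _ (by fun_prop)]
  refine setLIntegral_congr_fun measurableSet_Ioi fun x hx => ?_
  have hx : 0 < x := hx
  rw [ENNReal.tsum_mul_right]
  congr 1
  -- the Gamma densities add up to the constant `r`
  have h1 : HasSum (fun n : ℕ => r ^ (n + 1) * (x ^ n / n.factorial) * Real.exp (-(r * x))) r := by
    have h2 := (NormedSpace.expSeries_div_hasSum_exp (r * x)).mul_left (r * Real.exp (-(r * x)))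
    rw [← Real.exp_eq_exp_ℝ, mul_assoc, ← Real.exp_add, neg_add_cancel, Real.exp_zero, mul_one] at h2
    have h3 : (fun n : ℕ => r ^ (n + 1) * (x ^ n / n.factorial) * Real.exp (-(r * x))) =
        fun n => r * Real.exp (-(r * x)) * ((r * x) ^ n / n.factorial) := by
      funext n
      rw [mul_pow]
      ring
    rw [h3]
    exact h2
  rw [← ENNReal.ofReal_tsum_of_nonneg (fun n => by positivity) h1.summable, h1.tsum_eq]

/-! ### Independence of the driving variables -/

variable {K : ℕ}

/-- All rates of the system are positive. -/
structure Params.Positive (p : Params K) : Prop where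
  rewardRate : ∀ k, 0 < p.rewardRate k
  updateRate : 0 < p.updateRate
  decayRate : 0 < p.decayRate

theorem isProbabilityMeasure_clockLaw {p : Params K} (hp : p.Positive) (c : Clock K) :
    IsProbabilityMeasure (clockLaw p c) := by
  cases c with
  | initialLife k j => exact isProbabilityMeasure_expMeasure hp.decayRate
  | rewardGap k j => exact isProbabilityMeasure_expMeasure (hp.rewardRate k)
  | life k j => exact isProbabilityMeasure_expMeasure hp.decayRate
  | updateGap n => exact isProbabilityMeasure_expMeasure hp.updateRate
  | coin n => exact ⟨by simp [clockLaw]⟩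

theorem isProbabilityMeasure_systemLaw {p : Params K} (hp : p.Positive) (π : Measure (State K))
    [IsProbabilityMeasure π] : IsProbabilityMeasure (systemLaw p π) := by
  have := isProbabilityMeasure_clockLaw hp
  exact inferInstanceAs (IsProbabilityMeasure (π.prod (Measure.infinitePi (clockLaw p))))

open Classical in
/-- The sample point `ω` with the value of the driving variable `c` replaced by `x`. -/
noncomputable def resample (c : Clock K) (ω : Sample K) (x : ℝ) : Sample K :=
  (ω.1, Function.update ω.2 c x)

@[simp] theorem resample_fst (c : Clock K) (ω : Sample K) (x : ℝ) : (resample c ω x).1 = ω.1 := rfl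

@[simp] theorem resample_self (c : Clock K) (ω : Sample K) (x : ℝ) : (resample c ω x).2 c = x := by
  simp [resample]

theorem resample_of_ne {c d : Clock K} (h : d ≠ c) (ω : Sample K) (x : ℝ) :
    (resample c ω x).2 d = ω.2 d := by
  simp [resample, h]

theorem measurable_resample (c : Clock K) :
    Measurable fun q : Sample K × ℝ => resample c q.1 q.2 := by
  classical
  unfold resample
  refine Measurable.prodMk (by fun_prop) ?_
  exact measurable_update'.comp
    (Measurable.prodMk (measurable_snd.comp measurable_fst) measurable_snd)

/-- Replacing one driving variable by an independent copy preserves the law of the system. -/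
theorem measurePreserving_resample {p : Params K} (hp : p.Positive) (π : Measure (State K))
    [IsProbabilityMeasure π] (c : Clock K) :
    MeasurePreserving (fun q : Sample K × ℝ => resample c q.1 q.2)
      ((systemLaw p π).prod (clockLaw p c)) (systemLaw p π) := by
  classical
  have := isProbabilityMeasure_clockLaw hp
  have h1 : MeasurePreserving (fun q : (Clock K → ℝ) × ℝ => Function.update q.1 c q.2)
      ((Measure.infinitePi (clockLaw p)).prod (clockLaw p c))
      (Measure.infinitePi (clockLaw p)) := by
    refine ⟨measurable_update', ?_⟩
    refine Measure.eq_infinitePi _ fun s t ht => ?_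
    rw [Measure.map_apply measurable_update' (.pi s.countable_toSet fun i _ => ht i)]
    have h2 : (fun q : (Clock K → ℝ) × ℝ => Function.update q.1 c q.2) ⁻¹' (Set.pi s t) =
        (Set.pi (s.erase c : Finset (Clock K)) t) ×ˢ (if c ∈ s then t c else Set.univ) := by
      ext ⟨ω, x⟩
      simp only [Set.mem_preimage, Set.mem_pi, Set.mem_prod, Finset.coe_erase, Set.mem_sdiff,
        Finset.mem_coe, Set.mem_singleton_iff]
      constructor
      · intro h
        refine ⟨fun i hi => by simpa [hi.2] using h i hi.1, ?_⟩
        split_ifs with hc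
        · simpa using h c hc
        · trivial
      · rintro ⟨ha, hb⟩ i hi
        by_cases hic : i = c
        · subst hic; simpa [hi] using hb
        · simpa [hic] using ha i ⟨hi, hic⟩
    rw [h2, Measure.prod_prod, Measure.infinitePi_pi _ fun i _ => ht i]
    split_ifs with hc
    · rw [Finset.prod_erase_mul _ _ hc]
    · rw [measure_univ, mul_one, Finset.erase_eq_of_notMem hc]
  have h3 := (MeasurePreserving.id π).prod h1
  exact h3.comp (measurePreserving_prodAssoc π (Measure.infinitePi (clockLaw p)) (clockLaw p c))

/-- Integration over one driving variable first, which is how independence is used. -/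
theorem lintegral_resample {p : Params K} (hp : p.Positive) (π : Measure (State K))
    [IsProbabilityMeasure π] (c : Clock K) {F : Sample K → ℝ≥0∞} (hF : Measurable F) :
    ∫⁻ ω, F ω ∂systemLaw p π =
      ∫⁻ ω, ∫⁻ x, F (resample c ω x) ∂clockLaw p c ∂systemLaw p π := by
  have := isProbabilityMeasure_clockLaw hp
  have := isProbabilityMeasure_systemLaw hp π
  rw [← (measurePreserving_resample hp π c).lintegral_comp hF]
  exact lintegral_prod _ (hF.comp (measurable_resample c)).aemeasurable

/-- The lower bound that conditioning on all driving variables but one gives for the probability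
of an event, measurable or not. -/
theorem lintegral_resample_le_measure {p : Params K} (hp : p.Positive) (π : Measure (State K))
    [IsProbabilityMeasure π] (c : Clock K) (B : Set (Sample K)) :
    ∫⁻ ω, clockLaw p c {x | resample c ω x ∈ B} ∂systemLaw p π ≤ systemLaw p π B := by
  have := isProbabilityMeasure_clockLaw hp
  have := isProbabilityMeasure_systemLaw hp π
  rw [← measure_toMeasurable B, ← (measurePreserving_resample hp π c).measure_preimage
    (measurableSet_toMeasurable _ _).nullMeasurableSet,
    Measure.prod_apply (measurable_resample c (measurableSet_toMeasurable _ _))]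
  exact lintegral_mono fun ω => measure_mono fun x hx => subset_toMeasurable _ _ hx

/-! ### The number of living potential rewards -/

@[fun_prop]
theorem measurable_clock (c : Clock K) : Measurable fun ω : Sample K => ω.2 c :=
  (measurable_pi_apply c).comp measurable_snd

@[fun_prop]
theorem measurable_rewardTime (k : Fin K) (j : ℕ) :
    Measurable fun ω : Sample K => rewardTime ω k j := by
  unfold rewardTime
  fun_prop

theorem rewardTime_resample {c : Clock K} (k : Fin K) (j : ℕ)
    (hc : ∀ i ≤ j, c ≠ .rewardGap k i) (ω : Sample K) (x : ℝ) :
    rewardTime (resample c ω x) k j = rewardTime ω k j := by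
  refine Finset.sum_congr rfl fun i hi => resample_of_ne ?_ _ _
  exact (hc i (Nat.lt_succ_iff.1 (Finset.mem_range.1 hi))).symm

theorem rewardTime_succ (ω : Sample K) (k : Fin K) (j : ℕ) :
    rewardTime ω k (j + 1) = rewardTime ω k j + ω.2 (.rewardGap k (j + 1)) :=
  Finset.sum_range_succ _ _

/-- Given `T i`, the time `T (i + n)` is reached by `n` further exponential steps. -/
theorem lintegral_rewardTime_mul {p : Params K} (hp : p.Positive) (π : Measure (State K))
    [IsProbabilityMeasure π] (k : Fin K) (i n : ℕ) {g f : ℝ → ℝ≥0∞} (hg : Measurable g)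
    (hf : Measurable f) :
    ∫⁻ ω, g (rewardTime ω k i) * f (rewardTime ω k (i + n)) ∂systemLaw p π =
      ∫⁻ ω, g (rewardTime ω k i) * (expStep (p.rewardRate k))^[n] f (rewardTime ω k i)
        ∂systemLaw p π := by
  induction n generalizing f with
  | zero => simp
  | succ n ih =>
    rw [Function.iterate_succ_apply, ← ih (measurable_expStep (hp.rewardRate k) hf),
      lintegral_resample hp π (.rewardGap k (i + n + 1)) (by fun_prop)]
    refine lintegral_congr fun ω => ?_
    have h1 : ∀ j ≤ i + n, ∀ x, rewardTime (resample (.rewardGap k (i + n + 1)) ω x) k j =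
        rewardTime ω k j := by
      intro j hj x
      refine rewardTime_resample k j (fun l hl => ?_) ω x
      simp only [ne_eq, Clock.rewardGap.injEq, true_and]
      omega
    simp only [← add_assoc, rewardTime_succ, h1 i (by omega), h1 (i + n) le_rfl, resample_self]
    rw [lintegral_const_mul _ (by fun_prop)]
    rfl

theorem lintegral_rewardTime {p : Params K} (hp : p.Positive) (π : Measure (State K))
    [IsProbabilityMeasure π] (k : Fin K) (n : ℕ) {f : ℝ → ℝ≥0∞} (hf : Measurable f) :
    ∫⁻ ω, f (rewardTime ω k n) ∂systemLaw p π = (expStep (p.rewardRate k))^[n + 1] f 0 := by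
  have := isProbabilityMeasure_systemLaw hp π
  have h1 := lintegral_rewardTime_mul hp π k 0 n (g := fun _ => 1) measurable_const hf
  simp only [one_mul, zero_add] at h1
  have h2 := measurable_expStep_iterate (hp.rewardRate k) hf n
  rw [h1, lintegral_resample hp π (.rewardGap k 0) (by fun_prop), Function.iterate_succ_apply']
  simp [rewardTime, expStep, clockLaw]

/-- The indicator that the `j`-th potential reward of action `k` has come and is alive at time
`s`. -/
noncomputable def aliveInd (k : Fin K) (s : ℝ) (j : ℕ) (ω : Sample K) : ℝ≥0∞ :=
  {ω : Sample K | rewardTime ω k j ≤ s ∧ s < rewardTime ω k j + ω.2 (.life k j)}.indicator 1 ω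

/-- The number of potential rewards of action `k` alive at time `s`, accrued or not. It is infinite
if there are infinitely many, unlike the cardinality in `rewardsUnder`, which is then `0`; hence
`rewardsUnder_le` holds at every sample point. -/
noncomputable def aliveCount (k : Fin K) (s : ℝ) (ω : Sample K) : ℝ≥0∞ :=
  ∑' j, aliveInd k s j ω

/-- The probability that a reward that comes at time `u` is alive at time `s`. -/
noncomputable def survival (μ s u : ℝ) : ℝ≥0∞ :=
  (Set.Iic s).indicator (fun u => ENNReal.ofReal (Real.exp (-(μ * (s - u))))) u

@[fun_prop]
theorem measurable_survival (μ s : ℝ) : Measurable (survival μ s) :=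
  Measurable.indicator (by fun_prop) measurableSet_Iic

theorem measurable_aliveInd_uncurry (k : Fin K) (j : ℕ) :
    Measurable fun q : Sample K × ℝ => aliveInd k q.2 j q.1 := by
  have h1 : MeasurableSet {q : Sample K × ℝ | rewardTime q.1 k j ≤ q.2 ∧
      q.2 < rewardTime q.1 k j + q.1.2 (.life k j)} := by
    refine (measurableSet_le (f := fun q : Sample K × ℝ => rewardTime q.1 k j) ?_ ?_).inter
      (measurableSet_lt (g := fun q : Sample K × ℝ => rewardTime q.1 k j + q.1.2 (.life k j)) ?_ ?_)
    · exact (measurable_rewardTime k j).comp measurable_fst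
    · fun_prop
    · fun_prop
    · exact ((measurable_rewardTime k j).comp measurable_fst).add
        ((measurable_clock _).comp measurable_fst)
  exact Measurable.indicator (f := fun _ : Sample K × ℝ => (1 : ℝ≥0∞)) measurable_const h1

theorem measurable_aliveCount_uncurry (k : Fin K) :
    Measurable fun q : Sample K × ℝ => aliveCount k q.2 q.1 :=
  Measurable.tsum fun j => measurable_aliveInd_uncurry k j

@[fun_prop]
theorem measurable_aliveInd (k : Fin K) (s : ℝ) (j : ℕ) : Measurable (aliveInd k s j) :=
  (measurable_aliveInd_uncurry k j).comp (measurable_id.prodMk measurable_const)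

@[fun_prop]
theorem measurable_aliveCount (k : Fin K) (s : ℝ) : Measurable (aliveCount k s) :=
  (measurable_aliveCount_uncurry k).comp (measurable_id.prodMk measurable_const)

/-- Conditional on its time, the reward is alive at time `s` with probability `survival`. -/
theorem lintegral_resample_aliveInd {p : Params K} (hp : p.Positive) (k : Fin K) (s : ℝ) (j : ℕ)
    (ω : Sample K) :
    ∫⁻ x, aliveInd k s j (resample (.life k j) ω x) ∂clockLaw p (.life k j) =
      survival p.decayRate s (rewardTime ω k j) := by
  have h1 : ∀ x, rewardTime (resample (.life k j) ω x) k j = rewardTime ω k j := fun x =>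
    rewardTime_resample k j (fun i _ => by simp) ω x
  have h2 : ∀ x, aliveInd k s j (resample (.life k j) ω x) =
      {x | rewardTime ω k j ≤ s ∧ s - rewardTime ω k j < x}.indicator 1 x := by
    intro x
    simp [aliveInd, Set.indicator, h1, sub_lt_iff_lt_add']
  simp only [h2, survival]
  by_cases h : rewardTime ω k j ≤ s
  · simp only [h, true_and, Set.indicator, Set.mem_Iic, if_true]
    have := expMeasure_Ioi hp.decayRate (sub_nonneg.2 h)
    rw [← this, ← lintegral_indicator_one measurableSet_Ioi]
    rfl
  · simp [h, Set.indicator]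

theorem aliveInd_resample {c : Clock K} (k : Fin K) (s : ℝ) (j : ℕ)
    (hc : ∀ i ≤ j, c ≠ .rewardGap k i) (hc' : c ≠ .life k j) (ω : Sample K) (x : ℝ) :
    aliveInd k s j (resample c ω x) = aliveInd k s j ω := by
  simp [aliveInd, Set.indicator, rewardTime_resample k j hc, resample_of_ne hc'.symm]

theorem lintegral_aliveInd {p : Params K} (hp : p.Positive) (π : Measure (State K))
    [IsProbabilityMeasure π] (k : Fin K) (s : ℝ) (j : ℕ) :
    ∫⁻ ω, aliveInd k s j ω ∂systemLaw p π =
      ∫⁻ ω, survival p.decayRate s (rewardTime ω k j) ∂systemLaw p π := by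
  rw [lintegral_resample hp π (.life k j) (by fun_prop)]
  exact lintegral_congr fun ω => lintegral_resample_aliveInd hp k s j ω

theorem lintegral_aliveInd_mul {p : Params K} (hp : p.Positive) (π : Measure (State K))
    [IsProbabilityMeasure π] (k : Fin K) (s : ℝ) {i j : ℕ} (hij : i ≠ j) :
    ∫⁻ ω, aliveInd k s i ω * aliveInd k s j ω ∂systemLaw p π =
      ∫⁻ ω, survival p.decayRate s (rewardTime ω k i) * survival p.decayRate s (rewardTime ω k j)
        ∂systemLaw p π := by
  have h1 : ∫⁻ ω, aliveInd k s i ω * aliveInd k s j ω ∂systemLaw p π =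
      ∫⁻ ω, survival p.decayRate s (rewardTime ω k i) * aliveInd k s j ω ∂systemLaw p π := by
    rw [lintegral_resample hp π (.life k i) (by fun_prop)]
    refine lintegral_congr fun ω => ?_
    simp only [aliveInd_resample k s j (c := .life k i) (by simp) (by simpa using hij)]
    rw [lintegral_mul_const, lintegral_resample_aliveInd hp]
    exact (measurable_aliveInd k s i).comp
      ((measurable_resample _).comp (measurable_const.prodMk measurable_id))
  rw [h1, lintegral_resample hp π (.life k j) (by fun_prop)]
  refine lintegral_congr fun ω => ?_
  simp only [rewardTime_resample k i (c := .life k j) (by simp)]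
  rw [lintegral_const_mul, lintegral_resample_aliveInd hp]
  exact (measurable_aliveInd k s j).comp
    ((measurable_resample _).comp (measurable_const.prodMk measurable_id))

/-- Integration of a continuous nonnegative function with a known antiderivative. -/
theorem setLIntegral_ofReal_eq_sub {F f : ℝ → ℝ} {a : ℝ} (ha : 0 ≤ a)
    (hF : ∀ x, HasDerivAt F (f x) x) (hf : Continuous f) (hf0 : ∀ x ≤ a, 0 ≤ f x) :
    ∫⁻ x in Set.Ioc 0 a, ENNReal.ofReal (f x) = ENNReal.ofReal (F a - F 0) := by
  rw [← ofReal_integral_eq_lintegral_ofReal, ← intervalIntegral.integral_of_le ha,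
    intervalIntegral.integral_eq_sub_of_hasDerivAt (fun x _ => hF x)
      (hf.intervalIntegrable _ _)]
  · exact hf.integrableOn_Icc.mono_set Set.Ioc_subset_Icc_self
  · exact (ae_restrict_mem measurableSet_Ioc).mono fun x hx => hf0 x hx.2

theorem lintegral_survival {μ : ℝ} (hμ : 0 < μ) {s u : ℝ} (hu : u ≤ s) :
    ∫⁻ x in Set.Ioi 0, survival μ s (u + x) =
      ENNReal.ofReal ((1 - Real.exp (-(μ * (s - u)))) / μ) := by
  have h1 : ∀ x, HasDerivAt (fun x => Real.exp (-(μ * (s - (u + x)))) / μ)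
      (Real.exp (-(μ * (s - (u + x))))) x := by
    intro x
    have h := ((((((hasDerivAt_id x).const_add u).const_sub s).const_mul μ).neg).exp).div_const μ
    refine h.congr_deriv ?_
    simp
    field_simp
  have h2 := setLIntegral_ofReal_eq_sub (sub_nonneg.2 hu) h1 (by fun_prop)
    (fun x _ => (Real.exp_pos _).le)
  rw [← lintegral_indicator measurableSet_Ioi]
  rw [← lintegral_indicator measurableSet_Ioc] at h2
  convert h2 using 1
  · refine lintegral_congr fun x => ?_
    have : x ≤ s - u ↔ u + x ≤ s := le_sub_iff_add_le'
    by_cases hx : 0 < x <;> by_cases hxs : u + x ≤ s <;>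
      simp [survival, Set.indicator, hx, hxs, this]
  · congr 1
    simp
    ring

/-- Up to the factor `r ^ 2`, the left-hand side is the expected number of unordered pairs of living
potential rewards, that is, half the square of the mean. -/
theorem lintegral_survival_mul {μ : ℝ} (hμ : 0 < μ) {s : ℝ} (hs : 0 ≤ s) :
    ∫⁻ x in Set.Ioi 0, survival μ s x * ∫⁻ y in Set.Ioi 0, survival μ s (x + y) ≤
      ENNReal.ofReal (1 / μ ^ 2 / 2) := by
  have h1 : ∀ x, HasDerivAt (fun x => Real.exp (-(μ * (s - x))) / μ ^ 2 -
      Real.exp (-(μ * (s - x))) ^ 2 / (2 * μ ^ 2))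
      (Real.exp (-(μ * (s - x))) * ((1 - Real.exp (-(μ * (s - x)))) / μ)) x := by
    intro x
    have h := (((((hasDerivAt_id x).const_sub s).const_mul μ).neg).exp)
    refine ((h.div_const (μ ^ 2)).sub ((h.pow 2).div_const (2 * μ ^ 2))).congr_deriv ?_
    simp
    field_simp
  have h2 := setLIntegral_ofReal_eq_sub hs h1 (by fun_prop) (fun x hx => by
    have : Real.exp (-(μ * (s - x))) ≤ 1 := by
      rw [Real.exp_le_one_iff]
      have := mul_nonneg hμ.le (sub_nonneg.2 hx)
      linarith
    have := sub_nonneg.2 this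
    positivity)
  rw [← lintegral_indicator measurableSet_Ioi]
  rw [← lintegral_indicator measurableSet_Ioc] at h2
  refine le_trans (le_of_eq (Eq.trans ?_ h2)) ?_
  · refine lintegral_congr fun x => ?_
    by_cases hx : 0 < x <;> by_cases hxs : x ≤ s
    · simp only [Set.indicator, Set.mem_Ioi, Set.mem_Ioc, hx, hxs, if_true, and_self]
      rw [lintegral_survival hμ hxs, ENNReal.ofReal_mul (Real.exp_pos _).le]
      simp [survival, hxs]
    all_goals simp [survival, Set.indicator, hx, hxs]
  · apply ENNReal.ofReal_le_ofReal
    have h3 : Real.exp (-(μ * s)) ≤ 1 := by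
      rw [Real.exp_le_one_iff]
      have := mul_nonneg hμ.le hs
      linarith
    have h4 := Real.exp_pos (-(μ * s))
    simp only [sub_self, mul_zero, neg_zero, Real.exp_zero, sub_zero]
    have h5 : Real.exp (-(μ * s)) ^ 2 / (2 * μ ^ 2) ≤ Real.exp (-(μ * s)) / μ ^ 2 := by
      rw [div_le_div_iff₀ (by positivity) (by positivity)]
      have : Real.exp (-(μ * s)) ^ 2 ≤ Real.exp (-(μ * s)) * 2 := by nlinarith
      nlinarith [mul_le_mul_of_nonneg_right this (sq_nonneg μ)]
    have h6 : 1 / μ ^ 2 - 1 ^ 2 / (2 * μ ^ 2) = 1 / μ ^ 2 / 2 := by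
      field_simp
      norm_num
    linarith

/-! ### Moments of the number of living potential rewards -/

theorem lintegral_aliveCount {p : Params K} (hp : p.Positive) (π : Measure (State K))
    [IsProbabilityMeasure π] (k : Fin K) {s : ℝ} (hs : 0 ≤ s) :
    ∫⁻ ω, aliveCount k s ω ∂systemLaw p π =
      ENNReal.ofReal (p.rewardRate k * ((1 - Real.exp (-(p.decayRate * s))) / p.decayRate)) := by
  unfold aliveCount
  rw [lintegral_tsum fun j => (measurable_aliveInd k s j).aemeasurable]
  simp only [lintegral_aliveInd hp, lintegral_rewardTime hp π k _ (measurable_survival _ _)]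
  rw [tsum_expStep (hp.rewardRate k) (measurable_survival _ _), lintegral_survival hp.decayRate hs,
    ENNReal.ofReal_mul (hp.rewardRate k).le, sub_zero]

theorem lintegral_aliveCount_le {p : Params K} (hp : p.Positive) (π : Measure (State K))
    [IsProbabilityMeasure π] (k : Fin K) {s : ℝ} (hs : 0 ≤ s) :
    ∫⁻ ω, aliveCount k s ω ∂systemLaw p π ≤ ENNReal.ofReal (p.rewardRate k / p.decayRate) := by
  rw [lintegral_aliveCount hp π k hs]
  apply ENNReal.ofReal_le_ofReal
  have := hp.rewardRate k
  have := hp.decayRate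
  rw [← mul_div_assoc]
  gcongr
  have := Real.exp_pos (-(p.decayRate * s))
  nlinarith

/-- The square of a series, split into the diagonal and twice the part above it. -/
theorem sq_tsum_eq (a : ℕ → ℝ≥0∞) :
    (∑' i, a i) ^ 2 = ∑' i, a i * a i + 2 * ∑' i, ∑' n, a i * a (i + (n + 1)) := by
  have htail : ∀ (j : ℕ) (g : ℕ → ℝ≥0∞),
      ∑' i, (if j < i then g i else 0) = ∑' n, g (j + (n + 1)) := by
    intro j g
    rw [← Summable.sum_add_tsum_nat_add' (k := j + 1) ENNReal.summable,
      Finset.sum_eq_zero, zero_add]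
    · refine tsum_congr fun n => ?_
      rw [if_pos (by omega)]
      congr 1
      omega
    · intro i hi
      rw [if_neg]
      have := Finset.mem_range.1 hi
      omega
  have hsplit : ∀ i, ∑' j, a i * a j = ∑' j, (if j < i then a i * a j else 0) + a i * a i +
      ∑' j, (if i < j then a i * a j else 0) := by
    intro i
    have h1 : a i * a i = ∑' j, if j = i then a i * a j else 0 := by
      rw [tsum_ite_eq]
    rw [h1, ← ENNReal.tsum_add, ← ENNReal.tsum_add]
    refine tsum_congr fun j => ?_
    rcases lt_trichotomy i j with h | h | h
    · simp [h, h.not_gt, h.ne']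
    · simp [h]
    · simp [h, h.not_gt, h.ne]
  rw [sq, two_mul, ← ENNReal.tsum_mul_right]
  simp only [← ENNReal.tsum_mul_left]
  simp only [hsplit]
  rw [ENNReal.tsum_add, ENNReal.tsum_add, ENNReal.tsum_comm]
  have h2 : ∀ j, ∑' i, (if j < i then a i * a j else 0) = ∑' n, a j * a (j + (n + 1)) := by
    intro j
    rw [htail j fun i => a i * a j]
    exact tsum_congr fun n => mul_comm _ _
  have h3 : ∀ i, ∑' j, (if i < j then a i * a j else 0) = ∑' n, a i * a (i + (n + 1)) :=
    fun i => htail i fun j => a i * a j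
  simp only [h2, h3]
  ring

/-- Second moment of the number of living potential rewards: the pairs of rewards contribute at
most the square of the stationary mean. -/
theorem lintegral_aliveCount_sq_le {p : Params K} (hp : p.Positive) (π : Measure (State K))
    [IsProbabilityMeasure π] (k : Fin K) {s : ℝ} (hs : 0 ≤ s) :
    ∫⁻ ω, aliveCount k s ω ^ 2 ∂systemLaw p π ≤
      ENNReal.ofReal (p.rewardRate k / p.decayRate) +
        ENNReal.ofReal ((p.rewardRate k / p.decayRate) ^ 2) := by
  have hr := hp.rewardRate k
  have hμ := hp.decayRate
  have h1 : ∀ ω, aliveCount k s ω ^ 2 = aliveCount k s ω +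
      2 * ∑' i, ∑' n, aliveInd k s i ω * aliveInd k s (i + (n + 1)) ω := by
    intro ω
    unfold aliveCount
    rw [sq_tsum_eq]
    congr 1
    refine tsum_congr fun i => ?_
    by_cases h : rewardTime ω k i ≤ s ∧ s < rewardTime ω k i + ω.2 (.life k i) <;>
      simp [aliveInd, Set.indicator, h]
  have h2 : ∫⁻ ω, ∑' i, ∑' n, aliveInd k s i ω * aliveInd k s (i + (n + 1)) ω ∂systemLaw p π ≤
      ENNReal.ofReal ((p.rewardRate k / p.decayRate) ^ 2 / 2) := by
    rw [lintegral_tsum fun i => by fun_prop]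
    have h3 : ∀ i, ∫⁻ ω, ∑' n, aliveInd k s i ω * aliveInd k s (i + (n + 1)) ω ∂systemLaw p π =
        ∫⁻ ω, survival p.decayRate s (rewardTime ω k i) * (ENNReal.ofReal (p.rewardRate k) *
          ∫⁻ y in Set.Ioi 0, survival p.decayRate s (rewardTime ω k i + y)) ∂systemLaw p π := by
      intro i
      rw [lintegral_tsum fun i => by fun_prop]
      have h4 := measurable_expStep_iterate hr (measurable_survival p.decayRate s)
      simp only [← tsum_expStep hr (measurable_survival _ _)]
      simp only [← ENNReal.tsum_mul_left]
      rw [lintegral_tsum fun n => by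
        have := h4 (n + 1)
        fun_prop]
      refine tsum_congr fun n => ?_
      rw [lintegral_aliveInd_mul hp π k s (by omega), lintegral_rewardTime_mul hp π k i (n + 1)
        (measurable_survival _ _) (measurable_survival _ _)]
    have h5 : Measurable fun u => ∫⁻ y in Set.Ioi 0, survival p.decayRate s (u + y) :=
      Measurable.lintegral_prod_right'
        (f := fun q : ℝ × ℝ => survival p.decayRate s (q.1 + q.2)) (by fun_prop)
    simp only [h3]
    have h6 := lintegral_rewardTime hp π k (f := fun u => survival p.decayRate s u *
      (ENNReal.ofReal (p.rewardRate k) * ∫⁻ y in Set.Ioi 0, survival p.decayRate s (u + y)))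
    simp only [h6 _ (by fun_prop)]
    rw [tsum_expStep hr (by fun_prop)]
    simp only [zero_add, mul_left_comm _ (ENNReal.ofReal (p.rewardRate k))]
    rw [lintegral_const_mul _ (by fun_prop)]
    calc _ ≤ ENNReal.ofReal (p.rewardRate k) * (ENNReal.ofReal (p.rewardRate k) *
          ENNReal.ofReal (1 / p.decayRate ^ 2 / 2)) := by
          gcongr
          exact lintegral_survival_mul hμ hs
      _ = _ := by
          rw [← ENNReal.ofReal_mul hr.le, ← ENNReal.ofReal_mul hr.le]
          congr 1
          field_simp
  simp only [h1]
  rw [lintegral_add_left (by fun_prop), lintegral_const_mul _ (by fun_prop)]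
  refine add_le_add (lintegral_aliveCount_le hp π k hs) ?_
  calc _ ≤ 2 * ENNReal.ofReal ((p.rewardRate k / p.decayRate) ^ 2 / 2) := by gcongr
    _ = _ := by
      rw [show (2 : ℝ≥0∞) = ENNReal.ofReal 2 by simp, ← ENNReal.ofReal_mul (by norm_num)]
      congr 1
      ring

/-- The scaled deviation of the number of living potential rewards from the reward rate. -/
noncomputable def aliveDev (p : Params K) (k : Fin K) (s : ℝ) (ω : Sample K) : ℝ≥0∞ :=
  ENNReal.ofReal |p.decayRate * (aliveCount k s ω).toReal - p.rewardRate k|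

theorem measurable_aliveDev_uncurry (p : Params K) (k : Fin K) :
    Measurable fun q : Sample K × ℝ => aliveDev p k q.2 q.1 := by
  have := measurable_aliveCount_uncurry k
  unfold aliveDev
  fun_prop

@[fun_prop]
theorem measurable_aliveDev (p : Params K) (k : Fin K) (s : ℝ) : Measurable (aliveDev p k s) := by
  unfold aliveDev
  fun_prop

theorem ae_aliveCount_lt_top {p : Params K} (hp : p.Positive) (π : Measure (State K))
    [IsProbabilityMeasure π] (k : Fin K) {s : ℝ} (hs : 0 ≤ s) :
    ∀ᵐ ω ∂systemLaw p π, aliveCount k s ω < ∞ :=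
  ae_lt_top (by fun_prop)
    ((lintegral_aliveCount_le hp π k hs).trans_lt ENNReal.ofReal_lt_top).ne

/-- Law of large numbers for the number of living potential rewards, from its first two moments. -/
theorem lintegral_aliveDev_le {p : Params K} (hp : p.Positive) (π : Measure (State K))
    [IsProbabilityMeasure π] (k : Fin K) {s δ : ℝ} (hs : 0 ≤ s) (hδ : 0 < δ) :
    ∫⁻ ω, aliveDev p k s ω ∂systemLaw p π ≤
      ENNReal.ofReal (δ + (p.rewardRate k * p.decayRate +
        2 * p.rewardRate k ^ 2 * Real.exp (-(p.decayRate * s))) / δ) := by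
  have := isProbabilityMeasure_systemLaw hp π
  have hr := hp.rewardRate k
  have hμ := hp.decayRate
  set r := p.rewardRate k with hr_def
  set μ := p.decayRate with hμ_def
  set θ := Real.exp (-(μ * s)) with hθ_def
  have hθ0 : 0 < θ := Real.exp_pos _
  have hθ1 : θ ≤ 1 := by
    rw [hθ_def, Real.exp_le_one_iff]
    have := mul_nonneg hμ.le hs
    linarith
  -- the expanded square, with the mixed term kept on the left because `ℝ≥0∞` has no subtraction
  have h1 : ∫⁻ ω, aliveDev p k s ω ^ 2 ∂systemLaw p π +
      ENNReal.ofReal (2 * r ^ 2 * (1 - θ)) ≤ ENNReal.ofReal (r * μ + 2 * r ^ 2) := by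
    calc _ = ∫⁻ ω, aliveDev p k s ω ^ 2 ∂systemLaw p π +
          ENNReal.ofReal (2 * r * μ) * ∫⁻ ω, aliveCount k s ω ∂systemLaw p π := by
          rw [lintegral_aliveCount hp π k hs, ← ENNReal.ofReal_mul (by positivity)]
          rw [show 2 * r * μ * (p.rewardRate k * ((1 - Real.exp (-(p.decayRate * s))) /
              p.decayRate)) = 2 * r ^ 2 * (1 - θ) by
            change 2 * r * μ * (r * ((1 - θ) / μ)) = _
            field_simp]
      _ = ∫⁻ ω, (aliveDev p k s ω ^ 2 + ENNReal.ofReal (2 * r * μ) * aliveCount k s ω)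
            ∂systemLaw p π := by
          rw [lintegral_add_left (by fun_prop), lintegral_const_mul _ (by fun_prop)]
      _ = ∫⁻ ω, (ENNReal.ofReal (μ ^ 2) * aliveCount k s ω ^ 2 + ENNReal.ofReal (r ^ 2))
            ∂systemLaw p π := by
          refine lintegral_congr_ae ?_
          filter_upwards [ae_aliveCount_lt_top hp π k hs] with ω hω
          have h0 : aliveCount k s ω = ENNReal.ofReal (aliveCount k s ω).toReal :=
            (ENNReal.ofReal_toReal hω.ne).symm
          have hn : 0 ≤ (aliveCount k s ω).toReal := ENNReal.toReal_nonneg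
          unfold aliveDev
          rw [h0]
          rw [ENNReal.toReal_ofReal hn]
          rw [← ENNReal.ofReal_pow (abs_nonneg _), ← ENNReal.ofReal_mul (by positivity),
            ← ENNReal.ofReal_pow hn, ← ENNReal.ofReal_mul (by positivity),
            ← ENNReal.ofReal_add (by positivity) (by positivity),
            ← ENNReal.ofReal_add (by positivity) (by positivity), sq_abs]
          congr 1
          ring
      _ = ENNReal.ofReal (μ ^ 2) * ∫⁻ ω, aliveCount k s ω ^ 2 ∂systemLaw p π +
            ENNReal.ofReal (r ^ 2) := by
          rw [lintegral_add_left (by fun_prop), lintegral_const_mul _ (by fun_prop)]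
          simp
      _ ≤ ENNReal.ofReal (μ ^ 2) * (ENNReal.ofReal (r / μ) + ENNReal.ofReal ((r / μ) ^ 2)) +
            ENNReal.ofReal (r ^ 2) := by
          gcongr
          exact lintegral_aliveCount_sq_le hp π k hs
      _ = _ := by
          rw [← ENNReal.ofReal_add (by positivity) (by positivity),
            ← ENNReal.ofReal_mul (by positivity), ← ENNReal.ofReal_add (by positivity) (by positivity)]
          congr 1
          field_simp
          ring
  have h2 : ∫⁻ ω, aliveDev p k s ω ^ 2 ∂systemLaw p π ≤ ENNReal.ofReal (r * μ + 2 * r ^ 2 * θ) := by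
    refine (ENNReal.le_sub_of_add_le_right ENNReal.ofReal_ne_top h1).trans (le_of_eq ?_)
    rw [← ENNReal.ofReal_sub _ (mul_nonneg (by positivity) (sub_nonneg.2 hθ1))]
    congr 1
    ring
  -- `x ≤ δ + x ^ 2 / δ`
  calc _ ≤ ∫⁻ ω, (ENNReal.ofReal δ + ENNReal.ofReal δ⁻¹ * aliveDev p k s ω ^ 2)
        ∂systemLaw p π := by
        refine lintegral_mono fun ω => ?_
        unfold aliveDev
        rw [← ENNReal.ofReal_pow (abs_nonneg _), ← ENNReal.ofReal_mul (by positivity),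
            ← ENNReal.ofReal_add (by positivity) (by positivity)]
        apply ENNReal.ofReal_le_ofReal
        set x := |p.decayRate * (aliveCount k s ω).toReal - p.rewardRate k|
        have hx : 0 ≤ x := abs_nonneg _
        rw [← sub_nonneg]
        have : δ + δ⁻¹ * x ^ 2 - x = δ⁻¹ * ((δ - x) ^ 2 + δ * x) := by
          field_simp
          ring
        rw [this]
        positivity
    _ = ENNReal.ofReal δ + ENNReal.ofReal δ⁻¹ * ∫⁻ ω, aliveDev p k s ω ^ 2 ∂systemLaw p π := by
        rw [lintegral_add_left (by fun_prop), lintegral_const_mul _ (by fun_prop)]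
        simp
    _ ≤ ENNReal.ofReal δ + ENNReal.ofReal δ⁻¹ * ENNReal.ofReal (r * μ + 2 * r ^ 2 * θ) := by
        gcongr
    _ = _ := by
        rw [← ENNReal.ofReal_mul (by positivity), ← ENNReal.ofReal_add (by positivity) (by positivity)]
        congr 1
        field_simp

/-! ### The initial rewards -/

/-- The number of initial rewards of action `k` still alive at time `s`. -/
noncomputable def initialAlive (k : Fin K) (s : ℝ) (ω : Sample K) : ℝ≥0∞ :=
  ∑' j, {ω : Sample K | j < ω.1.1 k ∧ s < ω.2 (.initialLife k j)}.indicator 1 ω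

theorem measurable_initialAlive_uncurry (k : Fin K) :
    Measurable fun q : Sample K × ℝ => initialAlive k q.2 q.1 := by
  refine Measurable.tsum fun j => ?_
  have h1 : MeasurableSet {q : Sample K × ℝ | j < q.1.1.1 k ∧ q.2 < q.1.2 (.initialLife k j)} := by
    refine (measurableSet_lt (g := fun q : Sample K × ℝ => q.1.1.1 k) ?_ ?_).inter
      (measurableSet_lt (g := fun q : Sample K × ℝ => q.1.2 (.initialLife k j)) ?_ ?_)
    · fun_prop
    · fun_prop
    · fun_prop
    · exact (measurable_clock _).comp measurable_fst
  exact Measurable.indicator (f := fun _ : Sample K × ℝ => (1 : ℝ≥0∞)) measurable_const h1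

@[fun_prop]
theorem measurable_initialAlive (k : Fin K) (s : ℝ) : Measurable (initialAlive k s) :=
  (measurable_initialAlive_uncurry k).comp (measurable_id.prodMk measurable_const)

theorem tsum_indicator_one (s : Set ℕ) :
    ∑' j, s.indicator (1 : ℕ → ℝ≥0∞) j = s.encard := by
  rw [← ENNReal.tsum_set_one, ← tsum_subtype]
  rfl

theorem natCast_ncard_le_tsum (s : Set ℕ) :
    (s.ncard : ℝ≥0∞) ≤ ∑' j, s.indicator (1 : ℕ → ℝ≥0∞) j := by
  rw [tsum_indicator_one]
  have h := Set.ncard_le_encard s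
  exact_mod_cast ENat.toENNReal_le.2 h

theorem natCast_ncard_eq_tsum {s : Set ℕ} (hs : ∑' j, s.indicator (1 : ℕ → ℝ≥0∞) j ≠ ∞) :
    (s.ncard : ℝ≥0∞) = ∑' j, s.indicator (1 : ℕ → ℝ≥0∞) j := by
  rw [tsum_indicator_one] at hs ⊢
  have hf : s.Finite := by
    rw [← Set.encard_ne_top_iff]
    rintro h
    simp [h] at hs
  rw [← hf.cast_ncard_eq]
  simp

theorem initialAlive_eq (k : Fin K) (s : ℝ) (ω : Sample K) :
    initialAlive k s ω =
      ({j : ℕ | j < ω.1.1 k ∧ s < ω.2 (.initialLife k j)}.ncard : ℝ≥0∞) := by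
  symm
  have hf : {j : ℕ | j < ω.1.1 k ∧ s < ω.2 (.initialLife k j)}.Finite :=
    (Set.finite_lt_nat (ω.1.1 k)).subset fun j hj => hj.1
  refine natCast_ncard_eq_tsum ?_
  rw [tsum_indicator_one]
  simpa using hf

theorem initialAlive_le (k : Fin K) (s : ℝ) (ω : Sample K) :
    initialAlive k s ω ≤ ω.1.1 k := by
  rw [initialAlive_eq]
  have : {j : ℕ | j < ω.1.1 k ∧ s < ω.2 (.initialLife k j)}.ncard ≤ (Set.Iio (ω.1.1 k)).ncard :=
    Set.ncard_le_ncard (fun j hj => hj.1) (Set.finite_lt_nat _)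
  exact_mod_cast this.trans (by simp [Set.ncard_eq_toFinset_card'])

/-- The recallable rewards are at most the living ones, were all potential rewards accrued. -/
theorem rewardsUnder_le (ω : Sample K) (c : ℕ → Fin K) (t : ℝ) (k : Fin K) :
    (rewardsUnder ω c t k : ℝ≥0∞) ≤ initialAlive k t ω + aliveCount k t ω := by
  unfold rewardsUnder
  push_cast
  refine add_le_add (initialAlive_eq k t ω).ge ((natCast_ncard_le_tsum _).trans ?_)
  refine ENNReal.tsum_le_tsum fun j => ?_
  by_cases h : rewardTime ω k j ≤ t ∧ c (updateCount ω (rewardTime ω k j)) = k ∧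
    t < rewardTime ω k j + ω.2 (.life k j)
  · simp [aliveInd, Set.indicator, h]
  · simp [Set.indicator, h]

theorem lintegral_initialAlive {p : Params K} (hp : p.Positive) (π : Measure (State K))
    [IsProbabilityMeasure π] (k : Fin K) {s : ℝ} (hs : 0 ≤ s) :
    ∫⁻ ω, initialAlive k s ω ∂systemLaw p π =
      ENNReal.ofReal (Real.exp (-(p.decayRate * s))) * ∫⁻ ω, (ω.1.1 k : ℝ≥0∞) ∂systemLaw p π := by
  have hm : Measurable fun ω : Sample K => (ω.1.1 k : ℝ≥0∞) :=
    measurable_from_nat.comp ((measurable_pi_apply k).comp (measurable_fst.comp measurable_fst))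
  have h1 : ∀ ω : Sample K, (ω.1.1 k : ℝ≥0∞) =
      ∑' j, {ω : Sample K | j < ω.1.1 k}.indicator 1 ω := by
    intro ω
    have := natCast_ncard_eq_tsum (s := Set.Iio (ω.1.1 k)) (by
      rw [tsum_indicator_one]; simp)
    rw [Set.ncard_eq_toFinset_card'] at this
    simpa [Set.indicator] using this
  have hm1 : ∀ j, MeasurableSet {ω : Sample K | j < ω.1.1 k} := fun j =>
    measurableSet_lt (g := fun ω : Sample K => ω.1.1 k) measurable_const (by fun_prop)
  have hm2 : ∀ j, MeasurableSet {ω : Sample K | j < ω.1.1 k ∧ s < ω.2 (.initialLife k j)} :=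
    fun j => (hm1 j).inter (measurableSet_lt measurable_const (measurable_clock _))
  rw [← lintegral_const_mul _ hm]
  simp only [h1, initialAlive, ← ENNReal.tsum_mul_left]
  rw [lintegral_tsum fun j => (measurable_one.indicator (hm2 j)).aemeasurable,
    lintegral_tsum fun j => ((measurable_one.indicator (hm1 j)).const_mul _).aemeasurable]
  refine tsum_congr fun j => ?_
  rw [lintegral_resample hp π (.initialLife k j) (measurable_one.indicator (hm2 j))]
  refine lintegral_congr fun ω => ?_
  by_cases h : j < ω.1.1 k
  · simp only [Set.indicator, Set.mem_ofPred_eq, resample_fst, resample_self, h, true_and,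
      Pi.one_apply, if_true, mul_one]
    rw [← expMeasure_Ioi hp.decayRate hs, ← lintegral_indicator_one measurableSet_Ioi]
    rfl
  · simp [Set.indicator, h]

/-! ### Consequences of stationarity -/

/-- One half of stationarity for sets of states, by countable subadditivity. -/
theorem IsSteadyState.measure_joint_le {p : Params K} {π : Measure (State K)}
    (hπ : IsSteadyState p π) {t : ℝ} (ht : 0 ≤ t) (A : Set (State K)) :
    systemLaw p π {ω | joint p t ω ∈ A} ≤ π A := by
  have h1 : {ω | joint p t ω ∈ A} = ⋃ w ∈ A, {ω | joint p t ω = w} := by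
    ext ω; simp
  rw [h1]
  refine (measure_biUnion_le _ A.to_countable _).trans (le_of_eq ?_)
  simp only [hπ.2 t ht]
  rw [← measure_biUnion A.to_countable (fun a _ b _ hab => by simpa using hab)
    (fun w _ => measurableSet_singleton w)]
  simp

/-- Stationarity for sets of states. The outer measures of the events `joint p t ω = w` add up to
`1`, which forces equality also without knowing that these events are measurable. -/
theorem IsSteadyState.measure_joint {p : Params K} (hp : p.Positive) {π : Measure (State K)}
    (hπ : IsSteadyState p π) {t : ℝ} (ht : 0 ≤ t) (A : Set (State K)) :
    systemLaw p π {ω | joint p t ω ∈ A} = π A := by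
  have := hπ.1
  have := isProbabilityMeasure_systemLaw hp π
  refine le_antisymm (hπ.measure_joint_le ht A) ?_
  have h1 := hπ.measure_joint_le ht Aᶜ
  have h2 : 1 ≤ systemLaw p π {ω | joint p t ω ∈ A} + systemLaw p π {ω | joint p t ω ∈ Aᶜ} := by
    rw [← measure_univ (μ := systemLaw p π)]
    refine (measure_mono fun ω _ => ?_).trans (measure_union_le _ _)
    exact em (joint p t ω ∈ A)
  have h3 : π A + π Aᶜ = 1 := prob_add_prob_compl A.to_countable.measurableSet
  have h4 := (h3.le.trans h2).trans (add_le_add_right h1 _)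
  exact (ENNReal.add_le_add_iff_right (measure_ne_top π Aᶜ)).1 h4

theorem lintegral_initial_reward (p : Params K) (hp : p.Positive) (π : Measure (State K))
    [IsProbabilityMeasure π] (k : Fin K) :
    ∫⁻ ω, (ω.1.1 k : ℝ≥0∞) ∂systemLaw p π = ∫⁻ w, (w.1 k : ℝ≥0∞) ∂π := by
  have := isProbabilityMeasure_clockLaw hp
  exact (measurePreserving_fst (μ := π) (ν := Measure.infinitePi (clockLaw p))).lintegral_comp
    (f := fun w : State K => (w.1 k : ℝ≥0∞)) (measurable_of_countable _)

/-- A sum over the levels below a natural number or infinity is at most that number. -/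
theorem sum_range_indicator_lt_le (M : ℕ) (s : Set ℕ) :
    ∑ x ∈ Finset.range M, {N : ℝ≥0∞ | (x : ℝ≥0∞) < N}.indicator 1 (s.encard : ℝ≥0∞) ≤
      ((s.encard : ℝ≥0∞) : ℝ≥0∞) := by
  induction h : s.encard with
  | top => simp
  | coe n =>
    have h1 : ∀ x : ℕ, {N : ℝ≥0∞ | (x : ℝ≥0∞) < N}.indicator (1 : ℝ≥0∞ → ℝ≥0∞)
        (((n : ℕ∞) : ℝ≥0∞)) = if x < n then 1 else 0 := by
      intro x
      simp [Set.indicator]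
    simp only [h1, Finset.sum_boole]
    have : (Finset.filter (fun x => x < n) (Finset.range M)).card ≤ n := by
      calc _ ≤ (Finset.range n).card := Finset.card_le_card fun x hx => by simp_all
        _ = n := Finset.card_range n
    simpa using this

theorem tendsto_measure_initialAlive_ne_zero {p : Params K} (hp : p.Positive)
    (π : Measure (State K)) [IsProbabilityMeasure π] (k : Fin K) :
    Tendsto (fun n : ℕ => systemLaw p π {ω | initialAlive k n ω ≠ 0}) atTop (𝓝 0) := by
  have := isProbabilityMeasure_systemLaw hp π
  have h1 : ∀ (s : ℝ) (ω : Sample K), initialAlive k s ω ≠ 0 ↔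
      ∃ j < ω.1.1 k, s < ω.2 (.initialLife k j) := by
    intro s ω
    simp [initialAlive, ENNReal.tsum_eq_zero]
  have h2 : ⋂ n : ℕ, {ω | initialAlive k n ω ≠ 0} = ∅ := by
    refine Set.eq_empty_of_forall_notMem fun ω hω => ?_
    obtain ⟨n, hn⟩ := exists_nat_gt (∑ j ∈ Finset.range (ω.1.1 k), |ω.2 (.initialLife k j)|)
    obtain ⟨j, hj, hj'⟩ := (h1 _ _).1 (Set.mem_iInter.1 hω n)
    have h3 := Finset.single_le_sum (f := fun j => |ω.2 (.initialLife k j)|)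
      (fun i _ => abs_nonneg _) (Finset.mem_range.2 hj)
    have h4 := le_abs_self (ω.2 (.initialLife k j))
    linarith
  have h3 : Tendsto (fun n : ℕ => systemLaw p π {ω | initialAlive k n ω ≠ 0}) atTop
      (𝓝 (systemLaw p π (⋂ n : ℕ, {ω | initialAlive k n ω ≠ 0}))) := by
    refine tendsto_measure_iInter_atTop (fun n => ?_) ?_ ⟨0, measure_ne_top _ _⟩
    · exact ((measurable_initialAlive k n) (measurableSet_singleton 0).compl).nullMeasurableSet
    · intro a b hab ω hω
      obtain ⟨j, hj, hj'⟩ := (h1 _ _).1 hω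
      exact (h1 _ _).2 ⟨j, hj, lt_of_le_of_lt (by exact_mod_cast hab) hj'⟩
  rwa [h2, measure_empty] at h3

/-- In steady state the mean number of rewards of an action is at most that of the process which
always accrues this action. A steady state is not assumed to have a finite mean, so the truncated
means are compared, at a time when the initial rewards have disappeared. -/
theorem IsSteadyState.lintegral_reward_le {p : Params K} (hp : p.Positive) {π : Measure (State K)}
    (hπ : IsSteadyState p π) (k : Fin K) :
    ∫⁻ w, (w.1 k : ℝ≥0∞) ∂π ≤ ENNReal.ofReal (p.rewardRate k / p.decayRate) := by
  have := hπ.1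
  have := isProbabilityMeasure_systemLaw hp π
  -- the mean of `Q ∧ M` is the sum of the tail probabilities below `M`
  have htrunc : ∀ M : ℕ, ∫⁻ w, ((min (w.1 k) M : ℕ) : ℝ≥0∞) ∂π ≤
      ENNReal.ofReal (p.rewardRate k / p.decayRate) := by
    intro M
    have h1 : ∫⁻ w, ((min (w.1 k) M : ℕ) : ℝ≥0∞) ∂π =
        ∑ x ∈ Finset.range M, π {w | x < w.1 k} := by
      have h2 : ∀ w : State K, ((min (w.1 k) M : ℕ) : ℝ≥0∞) =
          ∑ x ∈ Finset.range M, {w : State K | x < w.1 k}.indicator 1 w := by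
        intro w
        simp only [Set.indicator, Set.mem_ofPred_eq, Pi.one_apply, Finset.sum_boole]
        congr 1
        have : Finset.filter (fun x => x < w.1 k) (Finset.range M) =
            Finset.range (min (w.1 k) M) := by
          ext x; simp [and_comm]
        rw [this, Finset.card_range]
      simp only [h2]
      rw [lintegral_finsetSum _ fun x _ => measurable_of_countable _]
      exact Finset.sum_congr rfl fun x _ =>
        lintegral_indicator_one (Set.to_countable _).measurableSet
    have h2 : ∀ n : ℕ, ∫⁻ w, ((min (w.1 k) M : ℕ) : ℝ≥0∞) ∂π ≤
        M * systemLaw p π {ω | initialAlive k n ω ≠ 0} +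
          ENNReal.ofReal (p.rewardRate k / p.decayRate) := by
      intro n
      rw [h1]
      calc _ ≤ ∑ x ∈ Finset.range M, (systemLaw p π {ω | initialAlive k n ω ≠ 0} +
            systemLaw p π {ω | (x : ℝ≥0∞) < aliveCount k n ω}) := by
            refine Finset.sum_le_sum fun x _ => ?_
            rw [← hπ.measure_joint hp n.cast_nonneg]
            refine (measure_mono fun ω hω => ?_).trans (measure_union_le _ _)
            have hω : x < rewardsUnder ω (choiceSeq p ω) n k := hω
            by_cases h0 : initialAlive k n ω = 0
            · right
              have h3 := rewardsUnder_le ω (choiceSeq p ω) n k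
              rw [h0, zero_add] at h3
              exact lt_of_lt_of_le (by exact_mod_cast hω) h3
            · exact Or.inl h0
        _ = M * systemLaw p π {ω | initialAlive k n ω ≠ 0} +
            ∑ x ∈ Finset.range M, systemLaw p π {ω | (x : ℝ≥0∞) < aliveCount k n ω} := by
            rw [Finset.sum_add_distrib]
            simp
        _ ≤ _ := by
            gcongr
            refine le_trans ?_ (lintegral_aliveCount_le hp π k n.cast_nonneg)
            have hm : ∀ x : ℕ, MeasurableSet {ω | (x : ℝ≥0∞) < aliveCount k n ω} := fun x =>
              measurableSet_lt measurable_const (measurable_aliveCount k n)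
            simp only [← lintegral_indicator_one (hm _)]
            rw [← lintegral_finsetSum _ fun x _ => measurable_one.indicator (hm x)]
            refine lintegral_mono fun ω => ?_
            have h4 : aliveCount k n ω =
                ({j | rewardTime ω k j ≤ n ∧ (n : ℝ) < rewardTime ω k j +
                  ω.2 (.life k j)}.encard : ℝ≥0∞) := by
              rw [← tsum_indicator_one]
              rfl
            have h5 := sum_range_indicator_lt_le M {j | rewardTime ω k j ≤ n ∧
              (n : ℝ) < rewardTime ω k j + ω.2 (.life k j)}
            rw [← h4] at h5
            exact h5
    have h3 : Tendsto (fun n : ℕ => M * systemLaw p π {ω | initialAlive k n ω ≠ 0} +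
          ENNReal.ofReal (p.rewardRate k / p.decayRate)) atTop
        (𝓝 (M * 0 + ENNReal.ofReal (p.rewardRate k / p.decayRate))) :=
      (ENNReal.Tendsto.const_mul (tendsto_measure_initialAlive_ne_zero hp π k)
        (Or.inr (by simp))).add_const _
    simpa using ge_of_tendsto' h3 h2
  have h1 : ∀ w : State K, (w.1 k : ℝ≥0∞) = ⨆ M : ℕ, ((min (w.1 k) M : ℕ) : ℝ≥0∞) := by
    intro w
    refine le_antisymm ?_ (iSup_le fun M => by exact_mod_cast min_le_left _ _)
    exact le_iSup_of_le (w.1 k) (by simp)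
  simp only [h1]
  rw [lintegral_iSup (fun M => measurable_of_countable _)
    (fun a b hab w => by
      have : min (w.1 k) a ≤ min (w.1 k) b := min_le_min_left _ hab
      exact_mod_cast this)]
  exact iSup_le htrunc

theorem IsSteadyState.lintegral_initialAlive_le {p : Params K} (hp : p.Positive)
    {π : Measure (State K)} (hπ : IsSteadyState p π) (k : Fin K) {s : ℝ} (hs : 0 ≤ s) :
    ∫⁻ ω, initialAlive k s ω ∂systemLaw p π ≤
      ENNReal.ofReal (p.rewardRate k / p.decayRate * Real.exp (-(p.decayRate * s))) := by
  have := hπ.1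
  rw [lintegral_initialAlive hp π k hs, lintegral_initial_reward p hp π k, mul_comm,
    ENNReal.ofReal_mul (div_nonneg (hp.rewardRate k).le hp.decayRate.le)]
  gcongr
  exact hπ.lintegral_reward_le hp k

/-! ### Lower bound on the probability of a choice -/

theorem measurePreserving_clock {p : Params K} (hp : p.Positive) (π : Measure (State K))
    [IsProbabilityMeasure π] (c : Clock K) :
    MeasurePreserving (fun ω : Sample K => ω.2 c) (systemLaw p π) (clockLaw p c) := by
  have := isProbabilityMeasure_clockLaw hp
  exact (measurePreserving_eval_infinitePi (clockLaw p) c).comp measurePreserving_snd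

/-- The first update point is independent of everything that it does not enter. -/
theorem lintegral_updateGap_zero {p : Params K} (hp : p.Positive) (π : Measure (State K))
    [IsProbabilityMeasure π] {F : Sample K → ℝ → ℝ≥0∞} (hF : Measurable (Function.uncurry F))
    (hF' : ∀ ω x s, F (resample (.updateGap 0) ω x) s = F ω s) :
    ∫⁻ ω, F ω (ω.2 (.updateGap 0)) ∂systemLaw p π =
      ∫⁻ s, ∫⁻ ω, F ω s ∂systemLaw p π ∂expMeasure p.updateRate := by
  have := isProbabilityMeasure_systemLaw hp π
  have := isProbabilityMeasure_clockLaw hp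
  rw [lintegral_resample hp π (.updateGap 0)
    (F := fun ω => F ω (ω.2 (.updateGap 0)))
    (hF.comp (measurable_id.prodMk (measurable_clock (K := K) (.updateGap 0))))]
  simp only [hF', resample_self]
  exact lintegral_lintegral_swap hF.aemeasurable

theorem ae_updateGap_pos {p : Params K} (hp : p.Positive) (π : Measure (State K))
    [IsProbabilityMeasure π] : ∀ᵐ ω ∂systemLaw p π, ∀ n, 0 < ω.2 (.updateGap n) := by
  rw [ae_all_iff]
  exact fun n => (measurePreserving_clock hp π (.updateGap n)).quasiMeasurePreserving.ae
    (ae_pos_expMeasure hp.updateRate)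

theorem monotone_updateTime {ω : Sample K} (hω : ∀ n, 0 < ω.2 (.updateGap n)) :
    Monotone (updateTime ω) :=
  monotone_nat_of_le_succ fun n => by
    rw [updateTime, updateTime, Finset.sum_range_succ]
    exact le_add_of_nonneg_right (hω n).le

theorem updateTime_one (ω : Sample K) : updateTime ω 1 = ω.2 (.updateGap 0) := by
  simp [updateTime]

theorem updateCount_eq_zero {ω : Sample K} (hω : ∀ n, 0 < ω.2 (.updateGap n)) {t : ℝ}
    (ht : t < ω.2 (.updateGap 0)) : updateCount ω t = 0 := by
  have : {n : ℕ | updateTime ω (n + 1) ≤ t} = ∅ := by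
    refine Set.eq_empty_of_forall_notMem fun n hn => ?_
    have h1 := monotone_updateTime hω (show 1 ≤ n + 1 by omega)
    rw [updateTime_one] at h1
    exact absurd (h1.trans hn) (not_le.2 ht)
  rw [updateCount, this, Set.ncard_empty]

theorem updateCount_eq_one {ω : Sample K} (hω : ∀ n, 0 < ω.2 (.updateGap n)) {t : ℝ}
    (ht : ω.2 (.updateGap 0) ≤ t) (ht' : t < ω.2 (.updateGap 1)) : updateCount ω t = 1 := by
  have : {n : ℕ | updateTime ω (n + 1) ≤ t} = {0} := by
    ext n
    simp only [Set.mem_ofPred_eq, Set.mem_singleton_iff]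
    constructor
    · intro hn
      by_contra h0
      have h1 := monotone_updateTime hω (show 2 ≤ n + 1 by omega)
      have h2 : updateTime ω 2 = ω.2 (.updateGap 0) + ω.2 (.updateGap 1) := by
        simp [updateTime, Finset.sum_range_succ]
      have := hω 0
      linarith
    · rintro rfl
      simpa [updateTime_one] using ht
  rw [updateCount, this, Set.ncard_singleton]

theorem choice_of_lt {p : Params K} {ω : Sample K} (hω : ∀ n, 0 < ω.2 (.updateGap n)) {t : ℝ}
    (ht : t < ω.2 (.updateGap 0)) : choice p t ω = ω.1.2 := by
  rw [choice, updateCount_eq_zero hω ht]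
  rfl

theorem embeddedChoice_zero {p : Params K} {ω : Sample K} (hω : ∀ n, 0 < ω.2 (.updateGap n)) :
    embeddedChoice p 0 ω = ω.1.2 :=
  choice_of_lt hω (by simpa [updateTime] using hω 0)

theorem choice_of_one_update {p : Params K} {ω : Sample K} (hω : ∀ n, 0 < ω.2 (.updateGap n))
    {t : ℝ} (ht : ω.2 (.updateGap 0) ≤ t) (ht' : t < ω.2 (.updateGap 1)) :
    choice p t ω = sampleAction
      (fun k => max (rewardsUnder ω (fun _ => ω.1.2) (ω.2 (.updateGap 0)) k : ℝ) p.explore)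
      (ω.2 (.coin 0)) ω.1.2 := by
  rw [choice, updateCount_eq_one hω ht ht', choiceSeq, choiceHistory]
  simp [updateTime_one, choiceHistory]

theorem updateTime_resample {c : Clock K} (hc : ∀ n, c ≠ .updateGap n) (ω : Sample K) (x : ℝ)
    (n : ℕ) : updateTime (resample c ω x) n = updateTime ω n :=
  Finset.sum_congr rfl fun i _ => resample_of_ne (hc i).symm _ _

theorem rewardsUnder_resample_coin (n : ℕ) (ω : Sample K) (x : ℝ) (c : ℕ → Fin K) (t : ℝ)
    (k : Fin K) : rewardsUnder (resample (.coin n) ω x) c t k = rewardsUnder ω c t k := by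
  simp [rewardsUnder, updateCount, updateTime_resample (c := .coin n),
    rewardTime_resample (c := .coin n), resample_of_ne (c := .coin n)]

theorem sampleAction_eq {w : Fin K → ℝ} (hw : ∀ i, 0 ≤ w i) {u : ℝ} {k : Fin K} (c : Fin K)
    (h1 : ∑ i ∈ Finset.Iio k, w i ≤ u * ∑ i, w i) (h2 : u * ∑ i, w i < ∑ i ∈ Finset.Iic k, w i) :
    sampleAction w u c = k := by
  have h3 : ∃ k : Fin K, u * ∑ i, w i < ∑ i ∈ Finset.Iic k, w i := ⟨k, h2⟩
  rw [sampleAction, dif_pos h3]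
  rw [Fin.find_eq_iff]
  refine ⟨h2, fun j hj => not_lt.2 (le_trans ?_ h1)⟩
  refine Finset.sum_le_sum_of_subset_of_nonneg (fun i hi => ?_) fun i _ _ => hw i
  simp only [Finset.mem_Iic, Finset.mem_Iio] at hi ⊢
  exact lt_of_le_of_lt hi hj

/-- The inversion rule samples `k` with probability at least proportional to its weight. -/
theorem le_volume_sampleAction {w : Fin K → ℝ} (hw : ∀ i, 0 ≤ w i) (k c : Fin K)
    (hk : 0 < w k) :
    ENNReal.ofReal (w k / ∑ i, w i) ≤
      (volume.restrict (Set.Icc (0 : ℝ) 1)) {u | sampleAction w u c = k} := by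
  set W := ∑ i, w i with hW
  have hW0 : 0 < W := lt_of_lt_of_le hk (Finset.single_le_sum (fun i _ => hw i) (Finset.mem_univ k))
  set a := ∑ i ∈ Finset.Iio k, w i with ha
  have ha0 : 0 ≤ a := Finset.sum_nonneg fun i _ => hw i
  have hb : ∑ i ∈ Finset.Iic k, w i = a + w k := by
    rw [← Finset.Iio_insert k, Finset.sum_insert (by simp), add_comm]
  have hbW : a + w k ≤ W := by
    rw [← hb]
    exact Finset.sum_le_sum_of_subset_of_nonneg (Finset.subset_univ _) fun i _ _ => hw i
  have h1 : Set.Ico (a / W) ((a + w k) / W) ⊆ {u | sampleAction w u c = k} := by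
    intro u hu
    refine sampleAction_eq hw c ?_ ?_
    · exact (div_le_iff₀ hW0).1 hu.1
    · rw [hb]
      exact (lt_div_iff₀ hW0).1 hu.2
  have h2 : Set.Ico (a / W) ((a + w k) / W) ⊆ Set.Icc 0 1 := fun u hu =>
    ⟨(div_nonneg ha0 hW0.le).trans hu.1, hu.2.le.trans ((div_le_one hW0).2 hbW)⟩
  refine le_trans ?_ (measure_mono h1)
  rw [Measure.restrict_apply measurableSet_Ico, Set.inter_eq_left.2 h2, Real.volume_Ico]
  apply ENNReal.ofReal_le_ofReal
  rw [← sub_div, add_sub_cancel_left]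

/-- The initial rewards together with the potential rewards alive at time `s`, over all actions. -/
noncomputable def totalBound (s : ℝ) (ω : Sample K) : ℝ≥0∞ :=
  ∑ i, ((ω.1.1 i : ℝ≥0∞) + aliveCount i s ω)

theorem measurable_totalBound_uncurry :
    Measurable fun q : Sample K × ℝ => totalBound q.2 q.1 := by
  refine Finset.measurable_sum _ fun i _ => Measurable.add ?_ (measurable_aliveCount_uncurry i)
  exact measurable_from_nat.comp ((measurable_pi_apply i).comp
    (measurable_fst.comp (measurable_fst.comp measurable_fst)))

theorem measurable_totalBound {f : Sample K → ℝ} (hf : Measurable f) :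
    Measurable fun ω => totalBound (f ω) ω := by
  have h : Measurable fun ω : Sample K => (ω, f ω) := measurable_id.prodMk hf
  have h' := measurable_totalBound_uncurry.comp h
  exact h'

theorem IsSteadyState.lintegral_totalBound_le {p : Params K} (hp : p.Positive)
    {π : Measure (State K)} (hπ : IsSteadyState p π) {s : ℝ} (hs : 0 ≤ s) :
    ∫⁻ ω, totalBound s ω ∂systemLaw p π ≤
      ENNReal.ofReal (2 * ∑ i, p.rewardRate i / p.decayRate) := by
  have := hπ.1
  have hq : ∀ i, Measurable fun ω : Sample K => (ω.1.1 i : ℝ≥0∞) := fun i =>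
    measurable_from_nat.comp ((measurable_pi_apply i).comp (measurable_fst.comp measurable_fst))
  have hnn : ∀ i, 0 ≤ p.rewardRate i / p.decayRate := fun i =>
    div_nonneg (hp.rewardRate i).le hp.decayRate.le
  unfold totalBound
  rw [lintegral_finsetSum (f := fun i (ω : Sample K) => (ω.1.1 i : ℝ≥0∞) + aliveCount i s ω) _
    fun i _ => (hq i).add (measurable_aliveCount i s), Finset.mul_sum,
    ENNReal.ofReal_sum_of_nonneg fun i _ => mul_nonneg two_pos.le (hnn i)]
  refine Finset.sum_le_sum fun i _ => ?_
  rw [lintegral_add_left (hq i), two_mul, ENNReal.ofReal_add (hnn i) (hnn i),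
    lintegral_initial_reward p hp π i]
  exact add_le_add (hπ.lintegral_reward_le hp i) (lintegral_aliveCount_le hp π i hs)

/-- By Markov's inequality the bound on the rewards holds at time `s` with probability at least
one half. -/
theorem IsSteadyState.half_le_measure_totalBound_le {p : Params K} (hp : p.Positive)
    {π : Measure (State K)} (hπ : IsSteadyState p π) (k : Fin K) {s : ℝ} (hs : 0 ≤ s) :
    1 / 2 ≤ systemLaw p π
      {ω | totalBound s ω ≤ ENNReal.ofReal (4 * ∑ i, p.rewardRate i / p.decayRate)} := by
  have := hπ.1
  have := isProbabilityMeasure_systemLaw hp π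
  have h0 := hπ.lintegral_totalBound_le hp hs
  set Λ := ∑ i, p.rewardRate i / p.decayRate with hΛ
  have hΛ0 : 0 < Λ := Finset.sum_pos (fun i _ => div_pos (hp.rewardRate i) hp.decayRate)
    ⟨k, Finset.mem_univ k⟩
  have hm : Measurable fun ω : Sample K => totalBound s ω := measurable_totalBound measurable_const
  have hb0 : ENNReal.ofReal (4 * Λ) ≠ 0 := by simp [hΛ0]
  have h1 : systemLaw p π {ω | ENNReal.ofReal (4 * Λ) ≤ totalBound s ω} ≤ 1 / 2 := by
    refine (meas_ge_le_lintegral_div hm.aemeasurable hb0 ENNReal.ofReal_ne_top).trans ?_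
    refine (ENNReal.div_le_div_right h0 _).trans ?_
    rw [← ENNReal.ofReal_div_of_pos (by positivity),
      show 2 * Λ / (4 * Λ) = 1 / 2 by field_simp; norm_num, ENNReal.ofReal_div_of_pos (by norm_num)]
    simp
  have h2 : (1 : ℝ≥0∞) ≤
      systemLaw p π {ω | totalBound s ω ≤ ENNReal.ofReal (4 * Λ)} + 1 / 2 := by
    calc (1 : ℝ≥0∞) = systemLaw p π Set.univ := measure_univ.symm
      _ ≤ _ := (measure_mono fun ω _ => le_total (totalBound s ω) _).trans
        ((measure_union_le _ _).trans (add_le_add_right h1 _))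
  have h3 : (1 / 2 : ℝ≥0∞) + 1 / 2 = 1 := ENNReal.add_halves 1
  exact (ENNReal.add_le_add_iff_right (a := 1 / 2) (by simp)).1 (h3.le.trans h2)

/-- The event that the only update point up to time `1 / updateRate` is the first one, and that at
most four times the stationary mean number of rewards are present there. -/
def singleUpdate (p : Params K) : Set (Sample K) :=
  {ω | ω.2 (.updateGap 0) ≤ 1 / p.updateRate ∧
    totalBound (ω.2 (.updateGap 0)) ω ≤ ENNReal.ofReal (4 * ∑ i, p.rewardRate i / p.decayRate) ∧
    1 / p.updateRate < ω.2 (.updateGap 1)}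

theorem measurableSet_singleUpdate (p : Params K) : MeasurableSet (singleUpdate p) := by
  have h1 : Measurable fun ω : Sample K => totalBound (ω.2 (.updateGap 0)) ω := measurable_totalBound (measurable_clock _)
  exact (measurableSet_le (measurable_clock _) measurable_const).inter
    ((measurableSet_le h1 measurable_const).inter
      (measurableSet_lt measurable_const (measurable_clock _)))

theorem totalBound_resample_updateGap (n : ℕ) (ω : Sample K) (x s : ℝ) :
    totalBound s (resample (.updateGap n) ω x) = totalBound s ω := by
  refine Finset.sum_congr rfl fun l _ => ?_
  rw [resample_fst]
  congr 1
  exact tsum_congr fun j => aliveInd_resample l s j (by simp) (by simp) ω x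

theorem IsSteadyState.le_measure_singleUpdate {p : Params K} (hp : p.Positive)
    {π : Measure (State K)} (hπ : IsSteadyState p π) (k : Fin K) :
    ENNReal.ofReal (Real.exp (-1) * ((1 - Real.exp (-1)) / 2)) ≤
      systemLaw p π (singleUpdate p) := by
  have := hπ.1
  have := isProbabilityMeasure_systemLaw hp π
  have hβ := hp.updateRate
  have hmarkov := fun s (hs : 0 ≤ s) => hπ.half_le_measure_totalBound_le hp k hs
  have hset := measurableSet_singleUpdate p
  obtain ⟨t, ht⟩ : ∃ t, t = 1 / p.updateRate := ⟨_, rfl⟩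
  obtain ⟨b, hb⟩ : ∃ b, b = ENNReal.ofReal (4 * ∑ i, p.rewardRate i / p.decayRate) := ⟨_, rfl⟩
  rw [← hb] at hmarkov
  have ht0 : 0 ≤ t := by rw [ht]; positivity
  have htβ : p.updateRate * t = 1 := by rw [ht]; field_simp
  obtain ⟨F, hF⟩ : ∃ F : Sample K → ℝ → ℝ≥0∞, ∀ ω s, F ω s =
    {q : Sample K × ℝ | q.2 ≤ t ∧ totalBound q.2 q.1 ≤ b}.indicator 1 (ω, s) := ⟨_, fun _ _ => rfl⟩
  have hFset : MeasurableSet {q : Sample K × ℝ | q.2 ≤ t ∧ totalBound q.2 q.1 ≤ b} :=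
    (measurableSet_le measurable_snd measurable_const).inter
      (measurableSet_le measurable_totalBound_uncurry measurable_const)
  have hFm : Measurable (Function.uncurry F) := by
    have : Function.uncurry F =
        {q : Sample K × ℝ | q.2 ≤ t ∧ totalBound q.2 q.1 ≤ b}.indicator 1 := by
      ext ⟨ω, s⟩
      exact hF ω s
    rw [this]
    exact measurable_one.indicator hFset
  have hFres : ∀ ω x s, F (resample (.updateGap 0) ω x) s = F ω s := by
    intro ω x s
    simp [hF, Set.indicator, totalBound_resample_updateGap]
  have e1 : ENNReal.ofReal (Real.exp (-1)) = expMeasure p.updateRate (Set.Ioi t) := by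
    rw [expMeasure_Ioi hβ ht0, htβ]
  have e2 : ENNReal.ofReal (1 - Real.exp (-1)) = expMeasure p.updateRate (Set.Iic t) := by
    rw [expMeasure_Iic hβ ht0, htβ]
  -- the gaps up to and after the first update point are integrated out in turn
  rw [← lintegral_indicator_one hset, lintegral_resample hp π (.updateGap 1)
    (measurable_one.indicator hset)]
  have h4 : ∀ ω, ∫⁻ x, (singleUpdate p).indicator 1
        (resample (.updateGap 1) ω x) ∂clockLaw p (.updateGap 1) =
      expMeasure p.updateRate (Set.Ioi t) * F ω (ω.2 (.updateGap 0)) := by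
    intro ω
    have h0 : ∀ x, (resample (.updateGap 1) ω x).2 (.updateGap 0) = ω.2 (.updateGap 0) :=
      fun x => resample_of_ne (by simp) ω x
    rw [← lintegral_indicator_one measurableSet_Ioi, ← lintegral_mul_const _
      (measurable_one.indicator measurableSet_Ioi)]
    refine lintegral_congr fun x => ?_
    simp only [singleUpdate, Set.indicator, Set.mem_ofPred_eq, h0, totalBound_resample_updateGap,
      resample_self, hF, Set.mem_Ioi, Pi.one_apply, ← ht, ← hb]
    by_cases h1 : ω.2 (.updateGap 0) ≤ t <;>
      by_cases h2 : totalBound (ω.2 (.updateGap 0)) ω ≤ b <;> simp [h1, h2]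
  simp only [h4]
  have hFm' : Measurable fun ω : Sample K => F ω (ω.2 (.updateGap 0)) :=
    hFm.comp (measurable_id.prodMk (measurable_clock (K := K) (.updateGap 0)))
  rw [lintegral_const_mul _ hFm', lintegral_updateGap_zero hp π hFm hFres, ENNReal.ofReal_mul (Real.exp_pos _).le, e1]
  gcongr
  calc ENNReal.ofReal ((1 - Real.exp (-1)) / 2) =
        ∫⁻ s, (Set.Iic t).indicator 1 s * (1 / 2) ∂expMeasure p.updateRate := by
        rw [lintegral_mul_const _ (measurable_one.indicator measurableSet_Iic),
          lintegral_indicator_one measurableSet_Iic, ← e2,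
          ENNReal.ofReal_div_of_pos (by norm_num), div_eq_mul_one_div]
        simp
    _ ≤ _ := by
        refine lintegral_mono_ae ?_
        filter_upwards [ae_pos_expMeasure hβ] with s hs
        by_cases hst : s ≤ t
        · have h5 : ∀ ω, F ω s = {ω | totalBound s ω ≤ b}.indicator 1 ω := by
            intro ω
            simp [hF, Set.indicator, hst]
          simp only [h5]
          rw [lintegral_indicator_one]
          · simpa [hst] using hmarkov s hs.le
          · exact measurableSet_le (measurable_totalBound measurable_const) measurable_const
        · simp [hst]

/-- Every action is in force with a probability that is bounded below in terms of the ratio of the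
exploration parameter and the stationary mean number of rewards only. -/
theorem IsSteadyState.le_measure_choice {p : Params K} (hp : p.Positive) (hα : 0 < p.explore)
    {π : Measure (State K)} (hπ : IsSteadyState p π) (k : Fin K) :
    ENNReal.ofReal (p.explore / (4 * ∑ i, p.rewardRate i / p.decayRate + K * p.explore)) *
      ENNReal.ofReal (Real.exp (-1) * ((1 - Real.exp (-1)) / 2)) ≤ π {w | w.2 = k} := by
  have := hπ.1
  have := isProbabilityMeasure_systemLaw hp π
  set Λ := ∑ i, p.rewardRate i / p.decayRate with hΛ
  have hΛ0 : 0 ≤ Λ := Finset.sum_nonneg fun i _ => div_nonneg (hp.rewardRate i).le hp.decayRate.le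
  set a := ENNReal.ofReal (p.explore / (4 * Λ + K * p.explore)) with ha
  rw [← hπ.measure_joint hp (t := 1 / p.updateRate) (one_div_pos.2 hp.updateRate).le {w | w.2 = k}]
  -- the weights at the first update point do not depend on the coin that is tossed there
  refine le_trans ?_ (lintegral_resample_le_measure hp π (.coin 0) _)
  calc _ ≤ a * systemLaw p π (singleUpdate p) := by
        gcongr
        exact hπ.le_measure_singleUpdate hp k
    _ ≤ ∫⁻ ω, a * (singleUpdate p).indicator 1 ω ∂systemLaw p π := by
        rw [lintegral_const_mul' _ _ ENNReal.ofReal_ne_top,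
          lintegral_indicator_one (measurableSet_singleUpdate p)]
    _ ≤ _ := by
        refine lintegral_mono_ae ?_
        filter_upwards [ae_updateGap_pos hp π] with ω hω
        by_cases hωG : ω ∈ singleUpdate p
        swap
        · simp [hωG]
        have hωG' := hωG
        obtain ⟨h1, h2, h3⟩ := hωG'
        have hpos : ∀ x n, 0 < (resample (.coin 0) ω x).2 (.updateGap n) := by
          intro x n
          rw [resample_of_ne (by simp)]
          exact hω n
        set w : Fin K → ℝ := fun i =>
          max (rewardsUnder ω (fun _ => ω.1.2) (ω.2 (.updateGap 0)) i : ℝ) p.explore with hw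
        have hset : {x | resample (.coin 0) ω x ∈
            {ω | joint p (1 / p.updateRate) ω ∈ {w : State K | w.2 = k}}} =
            {x | sampleAction w x ω.1.2 = k} := by
          ext x
          have h4 := choice_of_one_update (p := p) (hpos x)
            (t := 1 / p.updateRate) (by rwa [resample_of_ne (by simp)])
            (by rwa [resample_of_ne (by simp)])
          simp only [Set.mem_ofPred_eq, joint, h4, resample_self, resample_fst,
            rewardsUnder_resample_coin, resample_of_ne (c := Clock.coin 0)
              (d := Clock.updateGap 0) (by simp), hw]
        refine le_trans ?_ (congrArg (clockLaw p (.coin 0)) hset).ge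
        have hw0 : ∀ i, p.explore ≤ w i := fun i => le_max_right _ _
        refine le_trans ?_ (le_volume_sampleAction (fun i => hα.le.trans (hw0 i)) k ω.1.2
          (hα.trans_le (hw0 k)))
        have hsum : ∑ i, w i ≤ 4 * Λ + K * p.explore := by
          have h5 : ∑ i, (rewardsUnder ω (fun _ => ω.1.2) (ω.2 (.updateGap 0)) i : ℝ) ≤ 4 * Λ := by
            have h6 : ((∑ i, rewardsUnder ω (fun _ => ω.1.2) (ω.2 (.updateGap 0)) i : ℕ) : ℝ≥0∞) ≤
                ENNReal.ofReal (4 * Λ) := by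
              refine le_trans ?_ h2
              push_cast
              refine Finset.sum_le_sum fun i _ => (rewardsUnder_le _ _ _ _).trans ?_
              gcongr
              exact initialAlive_le _ _ _
            rw [← ENNReal.ofReal_natCast, ENNReal.ofReal_le_ofReal_iff (by positivity)] at h6
            exact_mod_cast h6
          calc ∑ i, w i ≤ ∑ i, ((rewardsUnder ω (fun _ => ω.1.2) (ω.2 (.updateGap 0)) i : ℝ) +
                p.explore) := Finset.sum_le_sum fun i _ =>
                  max_le (le_add_of_nonneg_right hα.le) (le_add_of_nonneg_left (Nat.cast_nonneg _))
            _ ≤ _ := by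
              rw [Finset.sum_add_distrib]
              simpa using h5
        have hsum0 : 0 < ∑ i, w i := Finset.sum_pos (fun i _ => hα.trans_le (hw0 i))
          ⟨k, Finset.mem_univ k⟩
        rw [Set.indicator_of_mem hωG, Pi.one_apply, mul_one]
        apply ENNReal.ofReal_le_ofReal
        exact div_le_div₀ (hα.le.trans (hw0 k)) (hw0 k) hsum0 hsum

/-! ### Error bounds conditional on the initial choice -/

/-- No potential reward comes exactly at the first update point. -/
theorem ae_rewardTime_ne {p : Params K} (hp : p.Positive) (π : Measure (State K))
    [IsProbabilityMeasure π] (k : Fin K) :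
    ∀ᵐ ω ∂systemLaw p π, ∀ j, rewardTime ω k j ≠ ω.2 (.updateGap 0) := by
  rw [ae_all_iff]
  intro j
  have hm : MeasurableSet {ω : Sample K | rewardTime ω k j = ω.2 (.updateGap 0)} :=
    measurableSet_eq_fun (measurable_rewardTime k j) (measurable_clock _)
  rw [ae_iff]
  simp only [ne_eq, not_not]
  rw [← lintegral_indicator_one hm, lintegral_resample hp π (.updateGap 0)
    (measurable_one.indicator hm)]
  refine (lintegral_congr fun ω => ?_).trans lintegral_zero
  have h1 : ∀ x, {ω : Sample K | rewardTime ω k j = ω.2 (.updateGap 0)}.indicator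
      (1 : Sample K → ℝ≥0∞) (resample (.updateGap 0) ω x) =
      ({rewardTime ω k j} : Set ℝ).indicator 1 x := by
    intro x
    simp [Set.indicator, rewardTime_resample (c := Clock.updateGap 0), eq_comm]
  simp only [h1]
  rw [lintegral_indicator_one (measurableSet_singleton _)]
  exact measure_singleton (μ := expMeasure p.updateRate) _

/-- As long as all rewards that have come did so before the first update point, the initial choice
alone decides which potential rewards are accrued. -/
theorem rewards_eq {p : Params K} {ω : Sample K} (hω : ∀ n, 0 < ω.2 (.updateGap n)) {i : Fin K}
    {s : ℝ} (hs : ∀ j, rewardTime ω i j ≤ s → rewardTime ω i j < ω.2 (.updateGap 0))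
    (hfin : aliveCount i s ω ≠ ∞) :
    (rewards p s ω i : ℝ≥0∞) =
      initialAlive i s ω + if ω.1.2 = i then aliveCount i s ω else 0 := by
  have h1 : ∀ j, rewardTime ω i j ≤ s → updateCount ω (rewardTime ω i j) = 0 := fun j hj =>
    updateCount_eq_zero hω (hs j hj)
  have h2 : {j : ℕ | rewardTime ω i j ≤ s ∧ choiceSeq p ω (updateCount ω (rewardTime ω i j)) = i ∧
      s < rewardTime ω i j + ω.2 (.life i j)} =
      {j : ℕ | ω.1.2 = i ∧ rewardTime ω i j ≤ s ∧ s < rewardTime ω i j + ω.2 (.life i j)} := by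
    ext j
    simp only [Set.mem_ofPred_eq]
    constructor
    · rintro ⟨ha, hb, hc⟩
      rw [h1 j ha] at hb
      exact ⟨hb, ha, hc⟩
    · rintro ⟨hb, ha, hc⟩
      refine ⟨ha, ?_, hc⟩
      rw [h1 j ha]
      exact hb
  rw [rewards, rewardsUnder, h2]
  push_cast
  rw [← initialAlive_eq]
  congr 1
  split_ifs with hi
  · simp only [hi, true_and]
    exact natCast_ncard_eq_tsum hfin
  · simp [hi]

/-- The scaled deviation of the rewards of action `i` at time `s` from the limit `q*` for the
choice `k`. -/
noncomputable def rewardDev (p : Params K) (k i : Fin K) (s : ℝ) (ω : Sample K) : ℝ≥0∞ :=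
  ENNReal.ofReal |p.decayRate * (rewards p s ω i : ℝ) - qStar p.rewardRate k i|

/-- As long as the initial choice is in force, the deviation is due to the surviving initial rewards
and the fluctuation of the potential ones. -/
theorem rewardDev_le {p : Params K} (hp : p.Positive) {ω : Sample K}
    (hω : ∀ n, 0 < ω.2 (.updateGap n)) {i : Fin K}
    {s : ℝ} (hs : ∀ j, rewardTime ω i j ≤ s → rewardTime ω i j < ω.2 (.updateGap 0))
    (hfin : aliveCount i s ω ≠ ∞) :
    rewardDev p ω.1.2 i s ω ≤
      ENNReal.ofReal p.decayRate * initialAlive i s ω + aliveDev p i s ω := by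
  have h1 := rewards_eq (p := p) hω hs hfin
  have hμ := hp.decayRate
  rw [initialAlive_eq] at h1 ⊢
  set a : ℕ := {j : ℕ | j < ω.1.1 i ∧ s < ω.2 (.initialLife i j)}.ncard
  have h2 : (rewards p s ω i : ℝ) = a + if ω.1.2 = i then (aliveCount i s ω).toReal else 0 := by
    have h3 := congrArg ENNReal.toReal h1
    rw [ENNReal.toReal_add (by simp) (by split_ifs <;> simp [hfin])] at h3
    split_ifs at h3 ⊢ <;> simpa using h3
  unfold rewardDev aliveDev
  rw [h2, ← ENNReal.ofReal_natCast a, ← ENNReal.ofReal_mul hμ.le,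
    ← ENNReal.ofReal_add (by positivity) (abs_nonneg _)]
  apply ENNReal.ofReal_le_ofReal
  by_cases hi : ω.1.2 = i
  · rw [if_pos hi, qStar, if_pos hi, hi, mul_add, add_sub_assoc]
    refine (abs_add_le _ _).trans ?_
    rw [abs_of_nonneg (by positivity)]
  · rw [if_neg hi, qStar, if_neg hi, add_zero, sub_zero, abs_of_nonneg (by positivity)]
    exact le_add_of_nonneg_right (abs_nonneg _)

/-- A bound on the deviation that holds whatever the choices were. -/
theorem rewardDev_le_add {p : Params K} (hp : p.Positive) (ω : Sample K) (i k : Fin K) (s : ℝ) :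
    rewardDev p k i s ω ≤ ENNReal.ofReal p.decayRate * initialAlive i s ω +
      (ENNReal.ofReal p.decayRate * aliveCount i s ω + ENNReal.ofReal (p.rewardRate i)) := by
  have hμ := hp.decayRate
  have hr := hp.rewardRate i
  have h1 : rewardDev p k i s ω ≤
      ENNReal.ofReal p.decayRate * (rewards p s ω i : ℝ≥0∞) + ENNReal.ofReal (p.rewardRate i) := by
    unfold rewardDev
    rw [← ENNReal.ofReal_natCast, ← ENNReal.ofReal_mul hμ.le,
      ← ENNReal.ofReal_add (by positivity) hr.le]
    apply ENNReal.ofReal_le_ofReal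
    refine (abs_sub _ _).trans ?_
    rw [abs_of_nonneg (by positivity : 0 ≤ p.decayRate * (rewards p s ω i : ℝ))]
    gcongr
    unfold qStar
    split_ifs with h
    · rw [h, abs_of_pos hr]
    · simpa using hr.le
  refine h1.trans ?_
  rw [← add_assoc, ← mul_add]
  gcongr
  exact rewardsUnder_le _ _ _ _

/-- The mean at a fixed time of the error bound in `rewardDev_le`. -/
theorem IsSteadyState.lintegral_error_le {p : Params K} (hp : p.Positive) {π : Measure (State K)}
    (hπ : IsSteadyState p π) (i : Fin K) {s δ : ℝ} (hs : 0 ≤ s) (hδ : 0 < δ) :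
    ∫⁻ ω, (ENNReal.ofReal p.decayRate * initialAlive i s ω + aliveDev p i s ω) ∂systemLaw p π ≤
      ENNReal.ofReal (δ + p.rewardRate i * p.decayRate / δ) +
        ENNReal.ofReal (p.rewardRate i + 2 * p.rewardRate i ^ 2 / δ) *
          ENNReal.ofReal (Real.exp (-(p.decayRate * s))) := by
  have := hπ.1
  have hμ := hp.decayRate
  have hr := hp.rewardRate i
  have hθ := Real.exp_pos (-(p.decayRate * s))
  rw [lintegral_add_left (by fun_prop), lintegral_const_mul _ (by fun_prop)]
  refine (add_le_add (mul_le_mul_right (hπ.lintegral_initialAlive_le hp i hs) _)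
    (lintegral_aliveDev_le hp π i hs hδ)).trans (le_of_eq ?_)
  rw [← ENNReal.ofReal_mul (by positivity), ← ENNReal.ofReal_mul (by positivity),
    ← ENNReal.ofReal_add (by positivity) (by positivity),
    ← ENNReal.ofReal_add (by positivity) (by positivity)]
  congr 1
  field_simp
  ring

/-- `C[0]` is the initial choice almost surely, as the first update point is positive. -/
theorem setOf_embeddedChoice_zero_ae_eq {p : Params K} (hp : p.Positive) (π : Measure (State K))
    [IsProbabilityMeasure π] (k : Fin K) :
    ({ω | embeddedChoice p 0 ω = k} : Set (Sample K)) =ᵐ[systemLaw p π] {ω | ω.1.2 = k} := by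
  rw [eventuallyEq_set]
  filter_upwards [ae_updateGap_pos hp π] with ω hω
  simp [embeddedChoice_zero hω]

theorem measurableSet_initial_choice (k : Fin K) : MeasurableSet {ω : Sample K | ω.1.2 = k} :=
  (measurable_snd.comp measurable_fst) (measurableSet_singleton k)

theorem measure_embeddedChoice_zero {p : Params K} (hp : p.Positive) (π : Measure (State K))
    [IsProbabilityMeasure π] (k : Fin K) :
    systemLaw p π {ω | embeddedChoice p 0 ω = k} = π {w | w.2 = k} := by
  have := isProbabilityMeasure_clockLaw hp
  rw [measure_congr (setOf_embeddedChoice_zero_ae_eq hp π k)]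
  exact (measurePreserving_fst (μ := π) (ν := Measure.infinitePi (clockLaw p))).measure_preimage
    (s := {w : State K | w.2 = k}) (Set.to_countable _).measurableSet.nullMeasurableSet

/-- Conditioning on the initial choice increases integrals at most by the inverse of its
probability. -/
theorem lintegral_cond_le {p : Params K} (hp : p.Positive) (π : Measure (State K))
    [IsProbabilityMeasure π] (k : Fin K) {f g : Sample K → ℝ≥0∞}
    (hfg : ∀ᵐ ω ∂systemLaw p π, ω.1.2 = k → f ω ≤ g ω) :
    ∫⁻ ω, f ω ∂ProbabilityTheory.cond (systemLaw p π) {ω | embeddedChoice p 0 ω = k} ≤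
      (π {w | w.2 = k})⁻¹ * ∫⁻ ω, g ω ∂systemLaw p π := by
  rw [ProbabilityTheory.cond, lintegral_smul_measure, measure_embeddedChoice_zero hp,
    Measure.restrict_congr_set (setOf_embeddedChoice_zero_ae_eq hp π k), smul_eq_mul]
  refine mul_le_mul_right ?_ _
  refine (lintegral_mono_ae ?_).trans (setLIntegral_le_lintegral {ω : Sample K | ω.1.2 = k} g)
  exact (ae_restrict_iff' (measurableSet_initial_choice k)).2 hfg

/-- Markov's inequality for the conditional law; the event need not be measurable. -/
theorem cond_apply_le {p : Params K} (hp : p.Positive) (π : Measure (State K))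
    [IsProbabilityMeasure π] (k : Fin K) {A : Set (Sample K)} {g : Sample K → ℝ≥0∞}
    (hg : Measurable g) {ε : ℝ≥0∞} (hε : ε ≠ 0) (hε' : ε ≠ ∞)
    (hA : ∀ᵐ ω ∂systemLaw p π, ω.1.2 = k → ω ∈ A → ε ≤ g ω) :
    ProbabilityTheory.cond (systemLaw p π) {ω | embeddedChoice p 0 ω = k} A ≤
      (π {w | w.2 = k})⁻¹ * (∫⁻ ω, g ω ∂systemLaw p π) / ε := by
  rw [ProbabilityTheory.cond, Measure.smul_apply, measure_embeddedChoice_zero hp,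
    Measure.restrict_congr_set (setOf_embeddedChoice_zero_ae_eq hp π k), smul_eq_mul, mul_div_assoc,
    Measure.restrict_apply' (measurableSet_initial_choice k)]
  gcongr
  refine (measure_mono_ae ?_).trans (meas_ge_le_lintegral_div hg.aemeasurable hε hε')
  filter_upwards [hA] with ω hω
  exact fun h => hω h.2 h.1

/-- The mean at the first update point of the error bound in `rewardDev_le`. -/
theorem IsSteadyState.lintegral_error_update_le {p : Params K} (hp : p.Positive)
    {π : Measure (State K)} (hπ : IsSteadyState p π) (i : Fin K) {δ : ℝ} (hδ : 0 < δ) :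
    ∫⁻ ω, (ENNReal.ofReal p.decayRate * initialAlive i (ω.2 (.updateGap 0)) ω +
        aliveDev p i (ω.2 (.updateGap 0)) ω) ∂systemLaw p π ≤
      ENNReal.ofReal (δ + p.rewardRate i * p.decayRate / δ +
        (p.rewardRate i + 2 * p.rewardRate i ^ 2 / δ) *
          (p.updateRate / (p.updateRate + p.decayRate))) := by
  have := hπ.1
  have := isProbabilityMeasure_expMeasure hp.updateRate
  have hμ := hp.decayRate
  have hr := hp.rewardRate i
  have hβ := hp.updateRate
  have hm : Measurable (Function.uncurry fun (ω : Sample K) (s : ℝ) =>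
      ENNReal.ofReal p.decayRate * initialAlive i s ω + aliveDev p i s ω) :=
    ((measurable_initialAlive_uncurry i).const_mul _).add (measurable_aliveDev_uncurry p i)
  rw [lintegral_updateGap_zero hp π hm]
  · calc _ ≤ ∫⁻ s, (ENNReal.ofReal (δ + p.rewardRate i * p.decayRate / δ) +
          ENNReal.ofReal (p.rewardRate i + 2 * p.rewardRate i ^ 2 / δ) *
            ENNReal.ofReal (Real.exp (-(p.decayRate * s)))) ∂expMeasure p.updateRate := by
          refine lintegral_mono_ae ?_
          filter_upwards [ae_pos_expMeasure hβ] with s hs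
          exact hπ.lintegral_error_le hp i hs.le hδ
      _ = _ := by
          rw [lintegral_add_left measurable_const, lintegral_const, measure_univ, mul_one,
            lintegral_const_mul _ (by fun_prop), lintegral_exp_neg_expMeasure hβ hμ,
            ← ENNReal.ofReal_mul (by positivity),
            ← ENNReal.ofReal_add (by positivity) (by positivity)]
  · intro ω x s
    have h1 : initialAlive i s (resample (.updateGap 0) ω x) = initialAlive i s ω := by
      simp [initialAlive, Set.indicator, resample_of_ne (c := Clock.updateGap 0)]
    have h2 : aliveCount i s (resample (.updateGap 0) ω x) = aliveCount i s ω :=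
      tsum_congr fun j => aliveInd_resample i s j (by simp) (by simp) ω x
    simp only [h1, h2, aliveDev]

/-- The contribution of an update point before time `s` to the error. -/
theorem lintegral_early_update_le {p : Params K} (hp : p.Positive) (π : Measure (State K))
    [IsProbabilityMeasure π] (i : Fin K) {s : ℝ} (hs : 0 ≤ s) :
    ∫⁻ ω, {ω : Sample K | ω.2 (.updateGap 0) ≤ s}.indicator (fun ω =>
        ENNReal.ofReal p.decayRate * aliveCount i s ω + ENNReal.ofReal (p.rewardRate i)) ω
        ∂systemLaw p π ≤
      ENNReal.ofReal (2 * p.rewardRate i * (s * p.updateRate)) := by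
  have := isProbabilityMeasure_systemLaw hp π
  have hμ := hp.decayRate
  have hr := hp.rewardRate i
  have hβ := hp.updateRate
  have hset : MeasurableSet {ω : Sample K | ω.2 (.updateGap 0) ≤ s} :=
    measurableSet_le (measurable_clock _) measurable_const
  rw [lintegral_resample hp π (.updateGap 0) (Measurable.indicator (by fun_prop) hset)]
  have h1 : ∀ ω : Sample K, ∫⁻ x, {ω : Sample K | ω.2 (.updateGap 0) ≤ s}.indicator (fun ω =>
      ENNReal.ofReal p.decayRate * aliveCount i s ω + ENNReal.ofReal (p.rewardRate i))
        (resample (.updateGap 0) ω x) ∂clockLaw p (.updateGap 0) =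
      expMeasure p.updateRate (Set.Iic s) *
        (ENNReal.ofReal p.decayRate * aliveCount i s ω + ENNReal.ofReal (p.rewardRate i)) := by
    intro ω
    rw [← lintegral_indicator_one measurableSet_Iic, ← lintegral_mul_const _
      (measurable_one.indicator measurableSet_Iic)]
    refine lintegral_congr fun x => ?_
    have h2 : aliveCount i s (resample (.updateGap 0) ω x) = aliveCount i s ω :=
      tsum_congr fun j => aliveInd_resample i s j (by simp) (by simp) ω x
    by_cases hx : x ≤ s <;> simp [hx, h2]
  simp only [h1]
  rw [lintegral_const_mul _ (by fun_prop), lintegral_add_right _ measurable_const,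
    lintegral_const_mul _ (by fun_prop), lintegral_const, measure_univ, mul_one,
    expMeasure_Iic hβ hs]
  calc _ ≤ ENNReal.ofReal (s * p.updateRate) * (ENNReal.ofReal p.decayRate *
        ENNReal.ofReal (p.rewardRate i / p.decayRate) + ENNReal.ofReal (p.rewardRate i)) := by
        gcongr
        · have := Real.add_one_le_exp (-(p.updateRate * s))
          linarith
        · exact lintegral_aliveCount_le hp π i hs
    _ = _ := by
        rw [← ENNReal.ofReal_mul hμ.le, mul_div_cancel₀ _ hμ.ne', ← ENNReal.ofReal_add hr.le hr.le,
          ← ENNReal.ofReal_mul (by positivity)]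
        congr 1
        ring

theorem ae_aliveCount_updateGap_lt_top {p : Params K} (hp : p.Positive) (π : Measure (State K))
    [IsProbabilityMeasure π] (i : Fin K) :
    ∀ᵐ ω ∂systemLaw p π, aliveCount i (ω.2 (.updateGap 0)) ω < ∞ := by
  have hpair : Measurable fun ω : Sample K => (ω, ω.2 (.updateGap 0)) :=
    measurable_id.prodMk (measurable_clock _)
  have hm := (measurable_aliveCount_uncurry i).comp hpair
  refine ae_lt_top hm (ne_of_lt ?_)
  have h1 := lintegral_updateGap_zero hp π
    (F := fun ω s => aliveCount i s ω) (measurable_aliveCount_uncurry i)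
    (fun ω x s => tsum_congr fun j => aliveInd_resample i s j (by simp) (by simp) ω x)
  have h2 : ∫⁻ s, ∫⁻ ω, aliveCount i s ω ∂systemLaw p π ∂expMeasure p.updateRate ≤
      ∫⁻ _, ENNReal.ofReal (p.rewardRate i / p.decayRate) ∂expMeasure p.updateRate := by
    refine lintegral_mono_ae ?_
    filter_upwards [ae_pos_expMeasure hp.updateRate] with s hs
    exact lintegral_aliveCount_le hp π i hs.le
  have := isProbabilityMeasure_expMeasure hp.updateRate
  rw [lintegral_const, measure_univ, mul_one] at h2
  exact (h1.le.trans h2).trans_lt ENNReal.ofReal_lt_top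

/-- Conditional on the initial choice, the rewards at the first update point are close to `q*`
with high probability. -/
theorem IsSteadyState.cond_error_update_le {p : Params K} (hp : p.Positive)
    {π : Measure (State K)} (hπ : IsSteadyState p π) (i k : Fin K) {ε δ : ℝ} (hε : 0 < ε)
    (hδ : 0 < δ) :
    ProbabilityTheory.cond (systemLaw p π) {ω | embeddedChoice p 0 ω = k}
        {ω | |p.decayRate * (embeddedRewards p 1 ω i : ℝ) - qStar p.rewardRate k i| ≤ ε}ᶜ ≤
      (π {w | w.2 = k})⁻¹ * ENNReal.ofReal (δ + p.rewardRate i * p.decayRate / δ +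
        (p.rewardRate i + 2 * p.rewardRate i ^ 2 / δ) *
          (p.updateRate / (p.updateRate + p.decayRate))) / ENNReal.ofReal ε := by
  have := hπ.1
  have hgm : Measurable fun ω : Sample K => ENNReal.ofReal p.decayRate *
      initialAlive i (ω.2 (.updateGap 0)) ω + aliveDev p i (ω.2 (.updateGap 0)) ω := by
    have hpair : Measurable fun ω : Sample K => (ω, ω.2 (.updateGap 0)) :=
      measurable_id.prodMk (measurable_clock _)
    have h1 := ((measurable_initialAlive_uncurry i).comp hpair).const_mul
      (ENNReal.ofReal p.decayRate)
    have h2 := (measurable_aliveDev_uncurry p i).comp hpair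
    exact h1.add h2
  refine (cond_apply_le hp π k hgm (ε := ENNReal.ofReal ε) (by simpa using hε)
    ENNReal.ofReal_ne_top ?_).trans ?_
  · filter_upwards [ae_updateGap_pos hp π, ae_rewardTime_ne hp π i,
      ae_aliveCount_updateGap_lt_top hp π i] with ω hω htie hfin hk hωA
    refine le_trans ?_ (rewardDev_le hp hω (i := i) (s := ω.2 (.updateGap 0))
      (fun j hj => lt_of_le_of_ne hj (htie j)) hfin.ne)
    apply ENNReal.ofReal_le_ofReal
    simp only [Set.mem_compl_iff, Set.mem_ofPred_eq, not_le, embeddedRewards,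
      updateTime_one] at hωA
    rw [hk]
    exact hωA.le
  · refine ENNReal.div_le_div_right (mul_le_mul_right ?_ _) _
    exact hπ.lintegral_error_update_le hp i hδ

/-- Conditional on the initial choice, the rewards at a fixed time are close to `q*` in mean. -/
theorem IsSteadyState.lintegral_cond_rewardDev_le {p : Params K} (hp : p.Positive)
    {π : Measure (State K)} (hπ : IsSteadyState p π) (i k : Fin K) {s δ : ℝ} (hs : 0 ≤ s)
    (hδ : 0 < δ) :
    ∫⁻ ω, rewardDev p k i s ω
        ∂ProbabilityTheory.cond (systemLaw p π) {ω | embeddedChoice p 0 ω = k} ≤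
      (π {w | w.2 = k})⁻¹ * ENNReal.ofReal (δ + p.rewardRate i * p.decayRate / δ +
        (p.rewardRate i + 2 * p.rewardRate i ^ 2 / δ) * Real.exp (-(p.decayRate * s)) +
          2 * p.rewardRate i * (s * p.updateRate)) := by
  have := hπ.1
  have hμ := hp.decayRate
  have hr := hp.rewardRate i
  have hβ := hp.updateRate
  have hset : MeasurableSet {ω : Sample K | ω.2 (.updateGap 0) ≤ s} :=
    measurableSet_le (measurable_clock _) measurable_const
  refine (lintegral_cond_le hp π k (g := fun ω =>
    ENNReal.ofReal p.decayRate * initialAlive i s ω + aliveDev p i s ω +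
      {ω : Sample K | ω.2 (.updateGap 0) ≤ s}.indicator (fun ω =>
        ENNReal.ofReal p.decayRate * aliveCount i s ω + ENNReal.ofReal (p.rewardRate i)) ω)
    ?_).trans (mul_le_mul_right ?_ _)
  · filter_upwards [ae_updateGap_pos hp π, ae_aliveCount_lt_top hp π i hs] with ω hω hfin hk
    by_cases hu : ω.2 (.updateGap 0) ≤ s
    · rw [Set.indicator_of_mem (by exact hu)]
      refine (rewardDev_le_add hp ω i k _).trans ?_
      gcongr
      exact le_self_add
    · rw [Set.indicator_of_notMem (by exact hu), add_zero, ← hk]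
      exact rewardDev_le hp hω (fun j hj => hj.trans_lt (not_le.1 hu)) hfin.ne
  · rw [lintegral_add_right _ (Measurable.indicator (by fun_prop) hset)]
    refine (add_le_add (hπ.lintegral_error_le hp i hs hδ)
      (lintegral_early_update_le hp π i hs)).trans (le_of_eq ?_)
    rw [← ENNReal.ofReal_mul (by positivity), ← ENNReal.ofReal_add (by positivity) (by positivity),
      ← ENNReal.ofReal_add (by positivity) (by positivity)]

/-! ### The limit in the scale parameter -/

theorem tendsto_zero_of_forall_le_mul {G : ℕ → ℝ≥0∞} {C : ℝ≥0∞} (hC : C ≠ ∞)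
    (h : ∀ δ : ℝ, 0 < δ → ∃ u : ℕ → ℝ, Tendsto u atTop (𝓝 0) ∧
      ∀ᶠ m in atTop, G m ≤ C * ENNReal.ofReal (δ + u m)) :
    Tendsto G atTop (𝓝 0) := by
  rw [ENNReal.tendsto_nhds_zero]
  intro ε hε
  obtain ⟨δ, hδ, hδε⟩ : ∃ δ : ℝ, 0 < δ ∧ C * ENNReal.ofReal (2 * δ) ≤ ε := by
    have h1 : Tendsto (fun δ : ℝ => C * ENNReal.ofReal (2 * δ)) (𝓝[>] 0) (𝓝 0) := by
      have h2 : Tendsto (fun δ : ℝ => ENNReal.ofReal (2 * δ)) (𝓝 0) (𝓝 0) := by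
        have h3 : Continuous fun δ : ℝ => ENNReal.ofReal (2 * δ) :=
          ENNReal.continuous_ofReal.comp (continuous_const_mul 2)
        simpa using h3.tendsto 0
      simpa using ENNReal.Tendsto.const_mul (h2.mono_left nhdsWithin_le_nhds) (Or.inr hC)
    obtain ⟨δ, h4, h5⟩ := ((ENNReal.tendsto_nhds_zero.1 h1 ε hε).and self_mem_nhdsWithin).exists
    exact ⟨δ, h5, h4⟩
  obtain ⟨u, hu, hG⟩ := h δ hδ
  filter_upwards [hG, hu.eventually (gt_mem_nhds hδ)] with m hm hum
  refine (hm.trans (mul_le_mul_right (ENNReal.ofReal_le_ofReal ?_) _)).trans hδε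
  linarith

theorem scaledParams_positive {lam : Fin K → ℝ} (hlam : ∀ k, 0 < lam k) (α₀ : ℝ) {β : ℕ → ℝ}
    {m : ℕ} (hm : 1 ≤ m) (hβ : 0 < β m) : (scaledParams lam α₀ β m).Positive where
  rewardRate := hlam
  updateRate := hβ
  decayRate := by
    have : (0 : ℝ) < m := by exact_mod_cast hm
    exact one_div_pos.2 this

/-- The scaling of the exploration parameter makes the lower bound on the probability of each
choice independent of the scale. -/
theorem exists_inv_measure_choice_le {lam : Fin K → ℝ} (hlam : ∀ k, 0 < lam k) {α₀ : ℝ}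
    (hα₀ : 0 < α₀) {β : ℕ → ℝ} (hβ : ∀ m, 1 ≤ m → 0 < β m) {π : ℕ → Measure (State K)}
    (hπ : ∀ m, 1 ≤ m → IsSteadyState (scaledParams lam α₀ β m) (π m)) (k : Fin K) :
    ∃ C : ℝ≥0∞, C ≠ ∞ ∧ ∀ m, 1 ≤ m → (π m {w | w.2 = k})⁻¹ ≤ C := by
  have hK : 0 < K := k.pos
  have hΛ : 0 ≤ ∑ i, lam i := Finset.sum_nonneg fun i _ => (hlam i).le
  have he : Real.exp (-1) < 1 := by
    rw [Real.exp_lt_one_iff]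
    norm_num
  refine ⟨(ENNReal.ofReal (α₀ / (4 * ∑ i, lam i + K * α₀)) *
    ENNReal.ofReal (Real.exp (-1) * ((1 - Real.exp (-1)) / 2)))⁻¹, ?_, fun m hm => ?_⟩
  · rw [ne_eq, ENNReal.inv_eq_top, mul_eq_zero, not_or]
    constructor
    · have : 0 < α₀ / (4 * ∑ i, lam i + K * α₀) := by positivity
      simpa using this
    · have : 0 < Real.exp (-1) * ((1 - Real.exp (-1)) / 2) :=
        mul_pos (Real.exp_pos _) (by linarith)
      simpa using this
  · have hm0 : (0 : ℝ) < m := by exact_mod_cast hm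
    have h1 := (hπ m hm).le_measure_choice (scaledParams_positive hlam α₀ hm (hβ m hm))
      (mul_pos hα₀ hm0) k
    refine ENNReal.inv_le_inv.2 (le_trans (le_of_eq ?_) h1)
    congr 2
    simp only [scaledParams]
    rw [← Finset.sum_div]
    field_simp

end FadingMemory

open FadingMemory

theorem mainTheorem8 {K : ℕ} (lam : Fin K → ℝ) (hlam : ∀ k, 0 < lam k)
    (α₀ : ℝ) (hα₀ : 0 < α₀)
    (β : ℕ → ℝ) (hβ : ∀ m, 1 ≤ m → 0 < β m)
    (hβm : β =o[atTop] fun m : ℕ => 1 / (m : ℝ))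
    (π : ℕ → Measure (FadingMemory.State K))
    (hπ : ∀ m, 1 ≤ m →
      FadingMemory.IsSteadyState (FadingMemory.scaledParams lam α₀ β m) (π m)) :
    -- the conditional probabilities are well defined
    (∀ m, 1 ≤ m → ∀ k : Fin K,
      FadingMemory.systemLaw (FadingMemory.scaledParams lam α₀ β m) (π m)
        {ω | FadingMemory.embeddedChoice (FadingMemory.scaledParams lam α₀ β m) 0 ω = k} ≠ 0) ∧
    (∀ i k : Fin K, ∀ ε : ℝ, 0 < ε →
      Tendsto
        (fun m : ℕ =>
          ProbabilityTheory.cond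
            (FadingMemory.systemLaw (FadingMemory.scaledParams lam α₀ β m) (π m))
            {ω | FadingMemory.embeddedChoice (FadingMemory.scaledParams lam α₀ β m) 0 ω = k}
            {ω | |(FadingMemory.embeddedRewards
                (FadingMemory.scaledParams lam α₀ β m) 1 ω i : ℝ) / m
              - FadingMemory.qStar lam k i| ≤ ε})
        atTop (𝓝 1)) ∧
    (∀ h : ℕ → ℕ, Tendsto (fun m : ℕ => (h m : ℝ) / m) atTop atTop →
      Tendsto (fun m : ℕ => (h m : ℝ) * β m) atTop (𝓝 0) →
      ∀ i k : Fin K,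
        Tendsto
          (fun m : ℕ =>
            ∫⁻ ω, ENNReal.ofReal
                |(FadingMemory.rewards (FadingMemory.scaledParams lam α₀ β m) (h m : ℝ) ω i : ℝ) / m
                  - FadingMemory.qStar lam k i|
              ∂(ProbabilityTheory.cond
                (FadingMemory.systemLaw (FadingMemory.scaledParams lam α₀ β m) (π m))
                {ω | FadingMemory.embeddedChoice
                  (FadingMemory.scaledParams lam α₀ β m) 0 ω = k}))
          atTop (𝓝 0)) := by
  have hpos : ∀ m, 1 ≤ m → (scaledParams lam α₀ β m).Positive := fun m hm =>
    scaledParams_positive hlam α₀ hm (hβ m hm)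
  have hne : ∀ m, 1 ≤ m → ∀ k : Fin K, systemLaw (scaledParams lam α₀ β m) (π m)
      {ω | embeddedChoice (scaledParams lam α₀ β m) 0 ω = k} ≠ 0 := by
    intro m hm k h0
    have := (hπ m hm).1
    obtain ⟨C, hC, hπC⟩ := exists_inv_measure_choice_le hlam hα₀ hβ hπ k
    have h1 := hπC m hm
    rw [measure_embeddedChoice_zero (hpos m hm)] at h0
    rw [h0, ENNReal.inv_zero, top_le_iff] at h1
    exact hC h1
  have hinv : Tendsto (fun m : ℕ => 1 / (m : ℝ)) atTop (𝓝 0) := tendsto_one_div_atTop_nhds_zero_nat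
  have hscale : ∀ (m : ℕ) (n : ℕ), (scaledParams lam α₀ β m).decayRate * (n : ℝ) = n / m :=
    fun m n => one_div_mul_eq_div _ _
  refine ⟨hne, fun i k ε hε => ?_, fun h hh hhβ i k => ?_⟩
  · obtain ⟨C, hC, hπC⟩ := exists_inv_measure_choice_le hlam hα₀ hβ hπ k
    have hε0 : ENNReal.ofReal ε ≠ 0 := by simpa using hε
    have hbad : Tendsto (fun m : ℕ => ProbabilityTheory.cond
        (systemLaw (scaledParams lam α₀ β m) (π m))
        {ω | embeddedChoice (scaledParams lam α₀ β m) 0 ω = k}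
        {ω | |(embeddedRewards (scaledParams lam α₀ β m) 1 ω i : ℝ) / m - qStar lam k i| ≤ ε}ᶜ)
        atTop (𝓝 0) := by
      refine tendsto_zero_of_forall_le_mul (ENNReal.div_ne_top hC hε0) fun δ hδ =>
        ⟨fun m => lam i * (1 / m) / δ +
          (lam i + 2 * lam i ^ 2 / δ) * (β m / (1 / m)), ?_, ?_⟩
      · have h1 := ((hinv.const_mul (lam i)).div_const δ).add
          (hβm.tendsto_div_nhds_zero.const_mul (lam i + 2 * lam i ^ 2 / δ))
        simpa using h1
      · filter_upwards [eventually_ge_atTop 1] with m hm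
        have hm0 : (0 : ℝ) < m := by exact_mod_cast hm
        have hl := hlam i
        have hb := hβ m hm
        have h1 := (hπ m hm).cond_error_update_le (hpos m hm) i k hε hδ
        simp only [hscale] at h1
        refine h1.trans ?_
        rw [ENNReal.mul_div_right_comm]
        refine mul_le_mul' (ENNReal.div_le_div_right (hπC m hm) _) (ENNReal.ofReal_le_ofReal ?_)
        simp only [scaledParams]
        rw [add_assoc]
        gcongr
        exact le_add_of_nonneg_left hb.le
    -- the event may fail to be measurable, so that its probability is only bounded below by that of
    -- the complement
    have hlow : Tendsto (fun m : ℕ => 1 - ProbabilityTheory.cond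
        (systemLaw (scaledParams lam α₀ β m) (π m))
        {ω | embeddedChoice (scaledParams lam α₀ β m) 0 ω = k}
        {ω | |(embeddedRewards (scaledParams lam α₀ β m) 1 ω i : ℝ) / m - qStar lam k i| ≤ ε}ᶜ)
        atTop (𝓝 1) := by
      simpa using ENNReal.Tendsto.sub (tendsto_const_nhds (x := (1 : ℝ≥0∞))) hbad (Or.inl (by simp))
    have hprob : ∀ m, 1 ≤ m → IsProbabilityMeasure (ProbabilityTheory.cond
        (systemLaw (scaledParams lam α₀ β m) (π m))
        {ω | embeddedChoice (scaledParams lam α₀ β m) 0 ω = k}) := by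
      intro m hm
      have := (hπ m hm).1
      have := isProbabilityMeasure_systemLaw (hpos m hm) (π m)
      exact ProbabilityTheory.cond_isProbabilityMeasure (hne m hm k)
    refine tendsto_of_tendsto_of_tendsto_of_le_of_le' hlow tendsto_const_nhds ?_ ?_
    · filter_upwards [eventually_ge_atTop 1] with m hm
      rw [tsub_le_iff_right, ← (hprob m hm).measure_univ]
      refine (measure_mono ?_).trans (measure_union_le _ _)
      rw [Set.union_compl_self]
    · filter_upwards [eventually_ge_atTop 1] with m hm
      have := hprob m hm
      exact prob_le_one
  · obtain ⟨C, hC, hπC⟩ := exists_inv_measure_choice_le hlam hα₀ hβ hπ k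
    refine tendsto_zero_of_forall_le_mul hC fun δ hδ => ⟨fun m => lam i * (1 / m) / δ +
      (lam i + 2 * lam i ^ 2 / δ) * Real.exp (-(h m / m)) + 2 * lam i * (h m * β m), ?_, ?_⟩
    · have h1 := (((hinv.const_mul (lam i)).div_const δ).add
        ((Real.tendsto_exp_neg_atTop_nhds_zero.comp hh).const_mul
          (lam i + 2 * lam i ^ 2 / δ))).add (hhβ.const_mul (2 * lam i))
      simpa using h1
    · filter_upwards [eventually_ge_atTop 1] with m hm
      have h1 := (hπ m hm).lintegral_cond_rewardDev_le (hpos m hm) i k (h m).cast_nonneg hδ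
      simp only [rewardDev, hscale] at h1
      refine h1.trans (mul_le_mul' (hπC m hm) (ENNReal.ofReal_le_ofReal (le_of_eq ?_)))
      simp only [scaledParams]
      ring
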